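/- **Queries.** A conjunctive query $Q(\mathbf x_F)\leftarrow\bigwedge_{J\in\mathcal E}R_J(\mathbf x_J)$ has variables $1,\dots,n$, finitely many atoms with schemas $J\subseteq[n]$ (repeated schemas are allowed) and free variables $F\subseteq[n]$; every variable occurs in some atom. A database $D$ gives a finite relation $R_J$ for every atom, $|D|$ is the total number of its tuples, $Q(D)$ is the set of restrictions to $F$ of the valuations of $[n]$ that satisfy all atoms, and $|\mathrm{OUT}|=|Q(D)|$. **Clique embeddings.** Let $\mathcal H'=([n],\mathcal E\cup\{F\})$. For $k\ge 3$, a $k$-clique embedding into $\mathcal H'$ is a map $\psi$ from $\{1,\dots,k\}$ to the non-empty subsets of $[n]$ such that every $\psi(i)$ induces a connected subgraph (two vertices being adjacent when they share a hyperedge), and for $i\ne j$ the sets $\psi(i),\psi(j)$ intersect or some hyperedge meets both. Put $d_\psi(J)=|\{i:\psi(i)\cap J\neq\emptyset\}|$, $d^+_\psi(F)=\sum_{v\in F}|\{i:v\in\psi(i)\}|$ and $\mathrm{wed}^F(\psi)=\max_{J}d_\psi(J)$, the maximum over the schemas $J$ of the atoms of $Q$ (the added edge $F$ does not count, but an atom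 of $Q$ whose schema happens to be $F$ does). **Algorithms.** Algorithms are programs of a deterministic random access machine with unit cost (arithmetic $+,-,\cdot,/$, comparisons, registers, addressable memory, random access to the input tables, loops, subroutine calls on fresh memory). Registers have $O(\log)$ of the input size many bits: numbers up to $(n+2)^{O(1)}$ for a graph on $n$ vertices given by its adjacency matrix, and up to $(|D|+V+2)^{O(1)}$ for a database with constants in $\{0,\dots,V\}$, given as lists of tuples in arbitrary order. Since "combinatorial algorithm" has no formal definition, let $\mathcal C$ be any class of programs ("the combinatorial algorithms") that is closed under elementary processing: if $A\in\mathcal C$, then $\mathcal C$ contains the program that computes an input for $A$ by an elementary program, runs $A$ once, and then runs an elementary program on the original input and the result of $A$. Here an elementary program consists of nested counting loops and comparisons that emit rows of arithmetic expressions in the loop variables and the cells of the tables it reads; it has no assignments, no writable memory, no unbounded loops and no subroutines. The Boolean $k$-Clique Conjecture for $\mathcal C$ says that for no $\varepsilon>0$ there is a program in $\mathcal C$ that decides whether an undirected $n$-vertex graph has a $k$-clique (accepting by a non-empty output) in $O(n^{k-\varepsilon})$ steps. **Theorem.** Let $Q$ be a conjunctive query, $\psi$ a $k$-clique embedding into $\mathcal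 H'$, and $x,y>0$ real with $$x\cdot\mathrm{wed}^F(\psi)+y\cdot d^+_\psi(F)\le k .$$ Let $\varepsilon,\varepsilon'\ge 0$ with $\varepsilon+\varepsilon'>0$, and with $\varepsilon>0$ in case $d^+_\psi(F)=0$. Assume the Boolean $k$-Clique Conjecture for $\mathcal C$. Then: 1. no algorithm in $\mathcal C$ evaluates $Q(D)$ on all databases $D$ in time $O\big(|D|^{x-\varepsilon}\cdot|\mathrm{OUT}|^{y-\varepsilon'}\big)$, where the running time is the number of steps plus $|D|$ for reading the input; 2. if $\mathrm{wed}^F(\psi)<k$, this holds even when the running time is only the number of steps. The constants in $O(\cdot)$ do not depend on $D$, and in the bounds $n$, $|D|$ and $|\mathrm{OUT}|$ are replaced by $1$ where they are $0$. -/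

import Mathlib

/-! ## Conjunctive queries -/

/-- A conjunctive query `Q(x_F) ← ⋀_j R_j(x_{schema j})` over the variables `Fin n`, with `m` atoms.
The atoms are indexed, so that two atoms may share a schema. Every variable occurs in an atom. -/
structure CQ where
  n : ℕ
  m : ℕ
  schema : Fin m → Finset (Fin n)
  free : Finset (Fin n)
  covers : ∀ v, ∃ j, v ∈ schema j

namespace CQ

/-- A database: one finite relation per atom; the constants are natural numbers. -/
abbrev Database (Q : CQ) : Type := ∀ j : Fin Q.m, Finset (Q.schema j → ℕ)

/-- `|D|`, the total number of tuples. -/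
def Database.size {Q : CQ} (D : Q.Database) : ℕ := ∑ j, (D j).card

/-- `Q(D)`: the restrictions to the free variables of the valuations that satisfy all atoms. -/
def answer (Q : CQ) (D : Q.Database) : Set (Q.free → ℕ) :=
  {t | ∃ v : Fin Q.n → ℕ, (∀ j, (fun a : Q.schema j => v a) ∈ D j) ∧ t = fun a : Q.free => v a}

theorem answer_finite (Q : CQ) (D : Q.Database) : (Q.answer D).Finite := by
  have hS : {v : Fin Q.n → ℕ | ∀ j, (fun a : Q.schema j => v a) ∈ D j}.Finite := by
    choose f hf using Q.covers
    refine (Set.Finite.pi' (ι := Fin Q.n) (t := fun a =>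
      (fun t : Q.schema (f a) → ℕ => t ⟨a, hf a⟩) '' (D (f a) : Set (Q.schema (f a) → ℕ)))
      fun a => ((D (f a)).finite_toSet.image _)).subset ?_
    intro v hv a
    exact ⟨_, hv (f a), rfl⟩
  refine (hS.image fun (v : Fin Q.n → ℕ) (a : Q.free) => v a).subset ?_
  rintro t ⟨v, hv, rfl⟩
  exact ⟨v, hv, rfl⟩

/-- `|OUT|`, the number of tuples in `Q(D)`. -/
noncomputable def outSize (Q : CQ) (D : Q.Database) : ℕ := (Q.answer D).ncard

/-- All constants of the database are at most `V`. -/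
def Database.ValuesLE {Q : CQ} (D : Q.Database) (V : ℕ) : Prop :=
  ∀ j, ∀ t ∈ D j, ∀ a, t a ≤ V

/-- The hyperedges of the hypergraph of `Q` extended by the edge of the free variables. -/
def extendedEdges (Q : CQ) : Set (Finset (Fin Q.n)) := insert Q.free (Set.range Q.schema)

end CQ

/-! ## Clique embeddings -/

section Embedding

variable {V : Type*} [DecidableEq V]

/-- Two vertices are adjacent when they are distinct and share a hyperedge. -/
def primalGraph (E : Set (Finset V)) : SimpleGraph V where
  Adj u v := u ≠ v ∧ ∃ e ∈ E, u ∈ e ∧ v ∈ e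
  symm := ⟨fun _ _ h => ⟨h.1.symm, h.2.imp fun _ he => ⟨he.1, he.2.2, he.2.1⟩⟩⟩
  loopless := ⟨fun _ h => h.1 rfl⟩

def Touch (E : Set (Finset V)) (X Y : Finset V) : Prop :=
  (X ∩ Y).Nonempty ∨ ∃ e ∈ E, (e ∩ X).Nonempty ∧ (e ∩ Y).Nonempty

/-- `ψ` is a `k`-clique embedding into the hypergraph with hyperedges `E`. -/
structure IsCliqueEmbedding (E : Set (Finset V)) (k : ℕ) (ψ : Fin k → Finset V) : Prop where
  three_le : 3 ≤ k
  nonempty : ∀ i, (ψ i).Nonempty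
  connected : ∀ i, ((primalGraph E).induce (ψ i : Set V)).Connected
  touch : ∀ i j, i ≠ j → Touch E (ψ i) (ψ j)

/-- The number of `i` such that `ψ i` meets `J`. -/
def weakEdgeDepth {k : ℕ} (ψ : Fin k → Finset V) (J : Finset V) : ℕ :=
  (Finset.univ.filter fun i => (ψ i ∩ J).Nonempty).card

/-- The weak edge depth counted with multiplicity: the sum over `v ∈ J` of `|ψ⁻¹(v)|`. -/
def edgeDepth {k : ℕ} (ψ : Fin k → Finset V) (J : Finset V) : ℕ :=
  ∑ v ∈ J, (Finset.univ.filter fun i => v ∈ ψ i).card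

end Embedding

/-- The largest weak edge depth among the hyperedges of the atoms of `Q`; the added edge of the
free variables is left out. -/
def CQ.wed (Q : CQ) {k : ℕ} (ψ : Fin k → Finset (Fin Q.n)) : ℕ :=
  Finset.univ.sup fun j => weakEdgeDepth ψ (Q.schema j)

/-! ## Random access machines with unit cost -/

/-- A table is an array of rows. -/
abbrev Table : Type := List (List ℕ)

/-- The input, the output and the results of subroutine calls are numbered tables. -/
abbrev Tables : Type := ℕ → Table

/-- The cell in row `i` and column `j`; zero if there is none. -/
def Table.cell (T : Table) (i j : ℕ) : ℕ := (T.getD i []).getD j 0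

inductive Expr where
  | const (c : ℕ)
  | reg (r : ℕ)
  | load (addr : Expr)
  | inp (a : ℕ) (i j : Expr)
  | inpLen (a : ℕ)
  | res (a : ℕ) (i j : Expr)
  | resLen (a : ℕ)
  | add (e f : Expr)
  | sub (e f : Expr)
  | mul (e f : Expr)
  | div (e f : Expr)

/-- * `set r e`: write the value of `e` to register `r`;
* `store a e`: write the value of `e` to the memory cell with address `a`;
* `emit a es`: append a row to table `a` of the outgoing buffer;
* `ite e f p q`: run `p` if `e ≤ f`, and `q` otherwise;
* `whileLE e f p`: repeat `p` as long as `e ≤ f`;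
* `loop r b p`: run `p` with register `r` equal to `0, …, b - 1`, then restore `r`;
* `call p`: run `p` as a subroutine, with its own registers and memory, on the outgoing buffer as
  its input; its output becomes the result tables, and the outgoing buffer is emptied. -/
inductive Prog where
  | skip
  | set (r : ℕ) (e : Expr)
  | store (addr e : Expr)
  | emit (a : ℕ) (es : List Expr)
  | seq (p q : Prog)
  | ite (e f : Expr) (p q : Prog)
  | whileLE (e f : Expr) (p : Prog)
  | loop (r : ℕ) (b : Expr) (p : Prog)
  | call (p : Prog)

/-- A configuration; the content of `buf` at the end of the run is the output. -/
structure State where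
  reg : ℕ → ℕ
  mem : ℕ → ℕ
  inp : Tables
  res : Tables
  buf : Tables

def State.init (T : Tables) : State where
  reg _ := 0
  mem _ := 0
  inp := T
  res _ := []
  buf _ := []

namespace Expr

def eval (s : State) : Expr → ℕ
  | const c => c
  | reg r => s.reg r
  | load a => s.mem (a.eval s)
  | inp a i j => (s.inp a).cell (i.eval s) (j.eval s)
  | inpLen a => (s.inp a).length
  | res a i j => (s.res a).cell (i.eval s) (j.eval s)
  | resLen a => (s.res a).length
  | add e f => e.eval s + f.eval s
  | sub e f => e.eval s - f.eval s
  | mul e f => e.eval s * f.eval s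
  | div e f => e.eval s / f.eval s

/-- Every value that occurs in the evaluation is at most `W`, that is, fits into a register. -/
def Fits (W : ℕ) (s : State) : Expr → Prop
  | const c => c ≤ W
  | reg r => s.reg r ≤ W
  | load a => a.Fits W s ∧ s.mem (a.eval s) ≤ W
  | inp a i j => i.Fits W s ∧ j.Fits W s ∧ (s.inp a).cell (i.eval s) (j.eval s) ≤ W
  | inpLen a => (s.inp a).length ≤ W
  | res a i j => i.Fits W s ∧ j.Fits W s ∧ (s.res a).cell (i.eval s) (j.eval s) ≤ W
  | resLen a => (s.res a).length ≤ W
  | add e f => e.Fits W s ∧ f.Fits W s ∧ e.eval s + f.eval s ≤ W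
  | sub e f => e.Fits W s ∧ f.Fits W s
  | mul e f => e.Fits W s ∧ f.Fits W s ∧ e.eval s * f.eval s ≤ W
  | div e f => e.Fits W s ∧ f.Fits W s

/-- The number of operations in an expression, each of which takes one step. -/
def cost : Expr → ℕ
  | const _ => 1
  | reg _ => 1
  | load a => a.cost + 1
  | inp _ i j => i.cost + j.cost + 1
  | inpLen _ => 1
  | res _ i j => i.cost + j.cost + 1
  | resLen _ => 1
  | add e f => e.cost + f.cost + 1
  | sub e f => e.cost + f.cost + 1
  | mul e f => e.cost + f.cost + 1
  | div e f => e.cost + f.cost + 1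

end Expr

/-- `Run W p s s' t`: started in `s` with registers that hold numbers up to `W`, the program `p`
halts in `s'` after `t` steps. A run that would exceed `W` is not a run. -/
inductive Run (W : ℕ) : Prog → State → State → ℕ → Prop where
  | skip (s : State) : Run W .skip s s 1
  | set (s : State) (r : ℕ) (e : Expr) (he : e.Fits W s) :
      Run W (.set r e) s { s with reg := Function.update s.reg r (e.eval s) } (e.cost + 1)
  | store (s : State) (a e : Expr) (ha : a.Fits W s) (he : e.Fits W s) :
      Run W (.store a e) s { s with mem := Function.update s.mem (a.eval s) (e.eval s) }
        (a.cost + e.cost + 1)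
  | emit (s : State) (a : ℕ) (es : List Expr) (hes : ∀ e ∈ es, e.Fits W s) :
      Run W (.emit a es) s
        { s with buf := Function.update s.buf a (s.buf a ++ [es.map fun e => e.eval s]) }
        ((es.map Expr.cost).sum + 1)
  | seq (s s₁ s₂ : State) (p q : Prog) (t₁ t₂ : ℕ) (hp : Run W p s s₁ t₁)
      (hq : Run W q s₁ s₂ t₂) : Run W (.seq p q) s s₂ (t₁ + t₂)
  | ite_true (s s' : State) (e f : Expr) (p q : Prog) (t : ℕ) (he : e.Fits W s) (hf : f.Fits W s)
      (h : e.eval s ≤ f.eval s) (hp : Run W p s s' t) :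
      Run W (.ite e f p q) s s' (e.cost + f.cost + 1 + t)
  | ite_false (s s' : State) (e f : Expr) (p q : Prog) (t : ℕ) (he : e.Fits W s) (hf : f.Fits W s)
      (h : ¬ e.eval s ≤ f.eval s) (hq : Run W q s s' t) :
      Run W (.ite e f p q) s s' (e.cost + f.cost + 1 + t)
  | while_true (s s₁ s₂ : State) (e f : Expr) (p : Prog) (t₁ t₂ : ℕ) (he : e.Fits W s)
      (hf : f.Fits W s) (h : e.eval s ≤ f.eval s) (hp : Run W p s s₁ t₁)
      (hw : Run W (.whileLE e f p) s₁ s₂ t₂) :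
      Run W (.whileLE e f p) s s₂ (e.cost + f.cost + 1 + t₁ + t₂)
  | while_false (s : State) (e f : Expr) (p : Prog) (he : e.Fits W s) (hf : f.Fits W s)
      (h : ¬ e.eval s ≤ f.eval s) : Run W (.whileLE e f p) s s (e.cost + f.cost + 1)
  | loop (s : State) (r : ℕ) (b : Expr) (p : Prog) (σ : ℕ → State) (τ : ℕ → ℕ) (hb : b.Fits W s)
      (h0 : σ 0 = s)
      (hp : ∀ i < b.eval s,
        Run W p { σ i with reg := Function.update (σ i).reg r i } (σ (i + 1)) (τ i)) :
      Run W (.loop r b p) s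
        { σ (b.eval s) with reg := Function.update (σ (b.eval s)).reg r (s.reg r) }
        (b.cost + 1 + ∑ i ∈ Finset.range (b.eval s), (τ i + 1))
  | call (s s' : State) (p : Prog) (t : ℕ) (hp : Run W p (State.init s.buf) s' t) :
      Run W (.call p) s { s with res := s'.buf, buf := fun _ => [] } (t + 1)

/-- On input `T`, the program outputs `O` after `t` steps, with registers for numbers up to `W`. -/
def Prog.Outputs (p : Prog) (W : ℕ) (T O : Tables) (t : ℕ) : Prop :=
  ∃ s, Run W p (State.init T) s t ∧ s.buf = O

/-! ## Elementary processing and classes of algorithms -/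

/-- Brute-force enumeration: nested loops and comparisons that emit rows. There is no assignment,
no writable memory, no unbounded iteration and no subroutine, so that every emitted row depends on
a bounded number of cells, and nothing can be accumulated. -/
def Prog.Elementary : Prog → Prop
  | .skip => True
  | .emit _ _ => True
  | .seq p q => p.Elementary ∧ q.Elementary
  | .ite _ _ p q => p.Elementary ∧ q.Elementary
  | .loop _ _ p => p.Elementary
  | _ => False

/-- If `A` is in the class, so is the program that prepares an input for `A` by an elementary
program, runs `A` once, and inspects the result by an elementary program. -/
def ClosedUnderElementaryProcessing (𝒞 : Set Prog) : Prop :=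
  ∀ A ∈ 𝒞, ∀ pre post : Prog, pre.Elementary → post.Elementary →
    Prog.seq pre (Prog.seq (Prog.call A) post) ∈ 𝒞

/-! ## The clique problem -/

open Classical in
/-- A graph is given by its adjacency matrix, as table `0`. -/
noncomputable def graphTables {n : ℕ} (G : SimpleGraph (Fin n)) : Tables
  | 0 => List.ofFn fun i => List.ofFn fun j => if G.Adj i j then 1 else 0
  | _ => []

/-- The program decides whether a graph on `n` vertices has a `k`-clique, in at most `τ n` steps
and with registers of `O(log n)` bits. It accepts by emitting at least one row to table `0`. -/
def DecidesClique (k : ℕ) (A : Prog) (τ : ℕ → ℝ) : Prop :=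
  ∃ c : ℕ, ∀ (n : ℕ) (G : SimpleGraph (Fin n)), ∃ (O : Tables) (t : ℕ),
    A.Outputs ((n + 2) ^ c) (graphTables G) O t ∧ (O 0 ≠ [] ↔ ¬ G.CliqueFree k) ∧ (t : ℝ) ≤ τ n

/-- No algorithm of the class `𝒞` decides the `k`-clique problem in time `O(n ^ (k - ε))` for any
`ε > 0`. -/
def BooleanCliqueConjecture (𝒞 : Set Prog) (k : ℕ) : Prop :=
  ¬ ∃ ε : ℝ, 0 < ε ∧ ∃ A ∈ 𝒞, ∃ C : ℝ,
    DecidesClique k A fun n => C * (max 1 n : ℝ) ^ ((k : ℝ) - ε)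

/-! ## The evaluation problem -/

/-- The values of a tuple in the order of the variables. -/
def rowOf {n : ℕ} {J : Finset (Fin n)} (t : J → ℕ) : List ℕ :=
  ((Finset.univ : Finset J).sort (· ≤ ·)).map t

/-- The table lists the tuples of the relation without repetition, in some order. -/
def Table.Lists {n : ℕ} {J : Finset (Fin n)} (T : Table) (S : Set (J → ℕ)) : Prop :=
  T.Nodup ∧ ∀ row, row ∈ T ↔ ∃ t ∈ S, row = rowOf t

/-- Table `j` lists the relation of the `j`-th atom; there are no further tables. -/
def CQ.Database.EncodedBy {Q : CQ} (D : Q.Database) (T : Tables) : Prop :=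
  (∀ j : Fin Q.m, (T j).Lists (D j : Set (Q.schema j → ℕ))) ∧ ∀ a, Q.m ≤ a → T a = []

/-- The program evaluates `Q`: on every database `D`, given in any order, table `0` of its output
lists `Q(D)`, and the number `t` of steps satisfies `P |D| |OUT| t`. The registers have
`O(log (|D| + V))` bits, where `V` bounds the constants in `D`. -/
def CQ.EvaluatedBy (Q : CQ) (A : Prog) (P : ℕ → ℕ → ℕ → Prop) : Prop :=
  ∃ c : ℕ, ∀ (D : Q.Database) (V : ℕ) (T : Tables), D.ValuesLE V → D.EncodedBy T →
    ∃ (O : Tables) (t : ℕ), A.Outputs ((D.size + V + 2) ^ c) T O t ∧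
      (O 0).Lists (Q.answer D) ∧ P D.size (Q.outSize D) t

/-! ## Runs of programs -/

/-! A graph on `n` vertices becomes a database whose valuations propose vertices for the `k`
indices. The constant for a variable `v` is a number in base `n` whose digit `i`, for `v ∈ ψ i`, is
the vertex proposed for `i`. The relation over `J` holds the codes of all cliques on the indices met
by `J`, so it has at most `n ^ weakEdgeDepth ψ J` tuples, and `|D| = O(n ^ wed)`. If the digits
agree within every hyperedge, they agree along each connected set `ψ i`, and touching sets then
yield adjacent vertices (`IsCliqueEmbedding.exists_clique`).

The added edge of the free variables is not an atom, so the database does not enforce consistency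
across it. Each answer is tested for it afterwards: the graph has a `k`-clique iff some answer
passes (`CQ.exists_digitsConsistent_iff`). Answers that fail still count in `|OUT|`, and different
free variables may propose different vertices for the same index; this is why the bound `n ^ d⁺`
counts with multiplicity.

Preparation and test are elementary and, together with the `t` steps of the evaluation, take `O(n ^
wed + t)` steps (`CQ.EvaluatedBy.decidesClique`). The hypotheses make `t = O(n ^ e)` with `e < k`,
so for `wed < k` a fast evaluation refutes the conjecture (`not_evaluatedBy_of_wed_lt`).

For `wed = k` writing the database may already take `n ^ k` steps, and the argument is
unconditional: `x k + y d⁺ ≤ k` makes the claimed time smaller than the time to read the input, on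
databases in which one variable varies (`not_evaluatedBy_of_wed_eq`). -/

theorem Expr.Fits.mono {W W' : ℕ} (h : W ≤ W') {s : State} {e : Expr} (he : e.Fits W s) :
    e.Fits W' s := by
  induction e <;> simp only [Expr.Fits] at * <;> grind

/-- Needed to embed the run of the evaluation algorithm, whose word size depends on `D`, into the
clique procedure, whose word size depends on the graph. -/
theorem Run.mono {W W' : ℕ} (h : W ≤ W') {p : Prog} {s s' : State} {t : ℕ}
    (hr : Run W p s s' t) : Run W' p s s' t := by
  induction hr with
  | skip s => exact .skip s
  | set s r e he => exact .set s r e (he.mono h)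
  | store s a e ha he => exact .store s a e (ha.mono h) (he.mono h)
  | emit s a es hes => exact .emit s a es fun e he => (hes e he).mono h
  | seq s s₁ s₂ p q t₁ t₂ _ _ hp hq => exact .seq s s₁ s₂ p q t₁ t₂ hp hq
  | ite_true s s' e f p q t he hf hle _ hp =>
    exact .ite_true s s' e f p q t (he.mono h) (hf.mono h) hle hp
  | ite_false s s' e f p q t he hf hle _ hp =>
    exact .ite_false s s' e f p q t (he.mono h) (hf.mono h) hle hp
  | while_true s s₁ s₂ e f p t₁ t₂ he hf hle _ _ hp hw =>
    exact .while_true s s₁ s₂ e f p t₁ t₂ (he.mono h) (hf.mono h) hle hp hw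
  | while_false s e f p he hf hle => exact .while_false s e f p (he.mono h) (hf.mono h) hle
  | loop s r b p σ τ hb h0 _ hp => exact .loop s r b p σ τ (hb.mono h) h0 hp
  | call s s' p t _ hp => exact .call s s' p t hp

/-- Every emitted row takes a step. -/
theorem Run.length_buf_le {W : ℕ} {p : Prog} {s s' : State} {t : ℕ} (hr : Run W p s s' t)
    (a : ℕ) : (s'.buf a).length ≤ (s.buf a).length + t := by
  induction hr with
  | skip s => simp
  | set s r e he => simp
  | store s a e ha he => simp
  | emit s b es hes =>
    by_cases hb : a = b
    · subst hb; simp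
    · simp [Function.update_of_ne hb]
  | seq s s₁ s₂ p q t₁ t₂ _ _ hp hq => omega
  | ite_true s s' e f p q t he hf hle _ hp => omega
  | ite_false s s' e f p q t he hf hle _ hp => omega
  | while_true s s₁ s₂ e f p t₁ t₂ he hf hle _ _ hp hw => omega
  | while_false s e f p he hf hle => omega
  | loop s r b p σ τ hb h0 _ hp =>
    have key : ∀ i ≤ b.eval s, ((σ i).buf a).length ≤
        (s.buf a).length + ∑ j ∈ Finset.range i, (τ j + 1) := by
      intro i
      induction i with
      | zero => intro _; simp [h0]
      | succ i ih =>
        intro hi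
        have h1 := ih (by omega)
        have h2 := hp i (by omega)
        rw [Finset.sum_range_succ]
        simp only at h2
        omega
    have := key _ le_rfl
    simp only
    omega
  | call s s' p t _ hp => simp

-- Expressions cannot read the outgoing buffer, so the effect of an emitting program can be stated
-- uniformly in the buffer it starts from.
@[simp]
theorem Expr.eval_buf (s : State) (B : Tables) (e : Expr) :
    e.eval { s with buf := B } = e.eval s := by
  induction e <;> simp_all [Expr.eval]

@[simp]
theorem Expr.fits_buf (W : ℕ) (s : State) (B : Tables) (e : Expr) :
    e.Fits W { s with buf := B } ↔ e.Fits W s := by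
  induction e <;> simp_all [Expr.Fits]

/-! ## Programs that only emit rows -/

/-- Within `T` steps the program appends the tables `f` to the outgoing buffer and changes nothing
else. -/
def Prog.Emits (W : ℕ) (p : Prog) (s : State) (f : Tables) (T : ℕ) : Prop :=
  ∀ B : Tables, ∃ t ≤ T,
    Run W p { s with buf := B } { s with buf := fun a => B a ++ f a } t

namespace Prog

variable {W : ℕ} {s : State}

theorem Emits.mono {p : Prog} {f : Tables} {T T' : ℕ} (h : p.Emits W s f T) (hT : T ≤ T') :
    p.Emits W s f T' := fun B =>
  let ⟨t, ht, hr⟩ := h B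
  ⟨t, ht.trans hT, hr⟩

theorem emits_skip : Prog.skip.Emits W s (fun _ => []) 1 := fun B =>
  ⟨1, le_rfl, by simpa using Run.skip (W := W) { s with buf := B }⟩

theorem emits_emit (a : ℕ) (es : List Expr) (hes : ∀ e ∈ es, e.Fits W s) :
    (Prog.emit a es).Emits W s (fun b => if b = a then [es.map fun e => e.eval s] else [])
      ((es.map Expr.cost).sum + 1) := fun B => by
  refine ⟨_, le_rfl, ?_⟩
  convert Run.emit (W := W) { s with buf := B } a es (by simpa using hes) using 2
  funext b
  by_cases hb : b = a
  · subst hb; simp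
  · simp [hb]

theorem Emits.seq {p q : Prog} {f g : Tables} {T₁ T₂ : ℕ} (hp : p.Emits W s f T₁)
    (hq : q.Emits W s g T₂) :
    (Prog.seq p q).Emits W s (fun a => f a ++ g a) (T₁ + T₂) := fun B => by
  obtain ⟨t₁, h₁, r₁⟩ := hp B
  obtain ⟨t₂, h₂, r₂⟩ := hq fun a => B a ++ f a
  exact ⟨t₁ + t₂, by omega, by simpa using Run.seq _ _ _ _ _ _ _ r₁ r₂⟩

theorem Emits.guard {e f : Expr} {p : Prog} {F : Tables} {T : ℕ} (he : e.Fits W s)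
    (hf : f.Fits W s) (hp : p.Emits W s F T) :
    (Prog.ite e f p .skip).Emits W s (fun a => if e.eval s ≤ f.eval s then F a else [])
      (e.cost + f.cost + 2 + T) := fun B => by
  by_cases h : e.eval s ≤ f.eval s
  · obtain ⟨t, ht, r⟩ := hp B
    refine ⟨e.cost + f.cost + 1 + t, by omega, ?_⟩
    simpa [h] using Run.ite_true _ _ e f p .skip t (by simpa using he) (by simpa using hf)
      (by simpa using h) r
  · refine ⟨e.cost + f.cost + 1 + 1, by omega, ?_⟩
    simpa [h] using Run.ite_false _ _ e f p .skip 1 (by simpa using he) (by simpa using hf)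
      (by simpa using h) (Run.skip (W := W) { s with buf := B })

theorem Emits.loop {r : ℕ} {b : Expr} {p : Prog} {f : ℕ → Tables} {T : ℕ} (hb : b.Fits W s)
    (hp : ∀ i < b.eval s, p.Emits W { s with reg := Function.update s.reg r i } (f i) T) :
    (Prog.loop r b p).Emits W s (fun a => (List.range (b.eval s)).flatMap fun i => f i a)
      (b.cost + 1 + b.eval s * (T + 1)) := fun B => by
  have hp' : ∀ i, ∃ t, i < b.eval s → t ≤ T ∧
      Run W p { s with reg := Function.update s.reg r i,
                       buf := fun a => B a ++ (List.range i).flatMap fun j => f j a }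
        { s with reg := Function.update s.reg r i,
                 buf := fun a => B a ++ (List.range (i + 1)).flatMap fun j => f j a } t := by
    intro i
    by_cases hi : i < b.eval s
    · obtain ⟨t, ht, hr⟩ := hp i hi fun a => B a ++ (List.range i).flatMap fun j => f j a
      refine ⟨t, fun _ => ⟨ht, ?_⟩⟩
      simpa [List.range_succ] using hr
    · exact ⟨0, fun h => absurd h hi⟩
  choose τ hτ using hp'
  -- Before the first pass the loop register has its old value; after pass `i` it holds `i`.
  let ρ : ℕ → ℕ → ℕ
    | 0 => s.reg
    | i + 1 => Function.update s.reg r i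
  have hρ : ∀ i j, Function.update (ρ i) r j = Function.update s.reg r j := by
    intro i j
    cases i <;> simp [ρ]
  let σ : ℕ → State := fun i =>
    { s with reg := ρ i, buf := fun a => B a ++ (List.range i).flatMap fun j => f j a }
  have hrun := Run.loop (W := W) { s with buf := B } r b p σ τ (by simpa using hb)
    (by simp [σ, ρ]) (by
      intro i hi
      simp only [σ, hρ]
      exact (hτ i (by simpa using hi)).2)
  simp only [Expr.eval_buf, σ, hρ, Function.update_eq_self] at hrun
  refine ⟨_, ?_, hrun⟩
  have : ∑ i ∈ Finset.range (b.eval s), (τ i + 1) ≤ ∑ i ∈ Finset.range (b.eval s), (T + 1) :=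
    Finset.sum_le_sum fun i hi => by
      have := (hτ i (Finset.mem_range.1 hi)).1
      omega
  simp only [Finset.sum_const, Finset.card_range, smul_eq_mul] at this
  omega

/-- Run `p` if `e ≤ f` for all pairs `(e, f)` in the list. -/
def guards (c : List (Expr × Expr)) (p : Prog) : Prog :=
  c.foldr (fun ef q => .ite ef.1 ef.2 q .skip) p

def guardsCost (c : List (Expr × Expr)) : ℕ := (c.map fun ef => ef.1.cost + ef.2.cost + 2).sum

theorem Elementary.guards {p : Prog} (hp : p.Elementary) (c : List (Expr × Expr)) :
    (guards c p).Elementary := by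
  induction c with
  | nil => exact hp
  | cons ef c ih => exact ⟨ih, trivial⟩

theorem Emits.guards {c : List (Expr × Expr)} {p : Prog} {F : Tables} {T : ℕ}
    (hc : ∀ ef ∈ c, ef.1.Fits W s ∧ ef.2.Fits W s) (hp : p.Emits W s F T) :
    (guards c p).Emits W s
      (fun a => if ∀ ef ∈ c, ef.1.eval s ≤ ef.2.eval s then F a else [])
      (guardsCost c + T) := by
  induction c with
  | nil => simpa [Prog.guards, guardsCost] using hp
  | cons ef c ih =>
    have := Emits.guard (hc ef (by simp)).1 (hc ef (by simp)).2
      (ih fun ef' h => hc ef' (by simp [h]))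
    change (Prog.ite ef.1 ef.2 (Prog.guards c p) .skip).Emits W s _ _
    simpa only [guardsCost, List.map_cons, List.sum_cons, add_assoc, List.forall_mem_cons,
      ite_and] using this

/-- Nested loops over the row numbers of input table `0`. -/
def nest (L : List ℕ) (p : Prog) : Prog := L.foldr (fun r q => .loop r (.inpLen 0) q) p

theorem Elementary.nest {p : Prog} (hp : p.Elementary) (L : List ℕ) : (nest L p).Elementary := by
  induction L with
  | nil => exact hp
  | cons r L ih => exact ih

/-- The tables emitted by nested loops whose body emits `f ρ` when the registers hold `ρ`. -/
def nestTables (N : ℕ) (f : (ℕ → ℕ) → Tables) : List ℕ → (ℕ → ℕ) → Tables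
  | [], ρ => f ρ
  | r :: L, ρ => fun a =>
      (List.range N).flatMap fun i => nestTables N f L (Function.update ρ r i) a

theorem Emits.nest {L : List ℕ} {p : Prog} {f : (ℕ → ℕ) → Tables} {T N : ℕ}
    (hN : (s.inp 0).length = N) (hNW : N ≤ W) (hs : ∀ r, s.reg r ≤ N)
    (hp : ∀ ρ : ℕ → ℕ, (∀ r, ρ r ≤ N) → p.Emits W { s with reg := ρ } (f ρ) T) :
    (nest L p).Emits W s (nestTables N f L s.reg) ((T + 3 * L.length) * (max 1 N) ^ L.length) := by
  induction L generalizing s with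
  | nil => simpa [Prog.nest, nestTables] using hp s.reg hs
  | cons r L ih =>
    have hev : (Expr.inpLen 0).eval s = N := hN
    have := Emits.loop (W := W) (s := s) (r := r) (b := .inpLen 0) (p := Prog.nest L p)
      (f := fun i => nestTables N f L (Function.update s.reg r i))
      (T := (T + 3 * L.length) * (max 1 N) ^ L.length)
      (by simpa [Expr.Fits, hN] using hNW) (by
        intro i hi
        rw [hev] at hi
        refine ih (s := { s with reg := Function.update s.reg r i }) hN ?_ hp
        intro r'
        by_cases h : r' = r
        · subst h; simpa using hi.le
        · simpa [h] using hs r')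
    rw [hev] at this
    refine this.mono ?_
    -- A level takes two steps to enter and one more per pass; the summand `3` pays for both. The
    -- `max 1 N` covers empty loops, which still take steps.
    simp only [Expr.cost, List.length_cons, pow_succ]
    set P := (max 1 N) ^ L.length
    have hP : 1 ≤ P := Nat.one_le_pow _ _ (by simp)
    have h1 : 1 ≤ max 1 N := le_max_left _ _
    have h2 : N ≤ max 1 N := le_max_right _ _
    generalize max 1 N = M at *
    have h3 : N * ((T + 3 * L.length) * P + 1) ≤ M * ((T + 3 * L.length) * P + 1) :=
      Nat.mul_le_mul_right _ h2
    nlinarith [Nat.mul_le_mul hP h1]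

/-- Replaces the recursion over the loops by a single quantifier over register contents. -/
theorem mem_nestTables {N : ℕ} {f : (ℕ → ℕ) → Tables} {L : List ℕ} {ρ : ℕ → ℕ} {a : ℕ}
    {row : List ℕ} : row ∈ nestTables N f L ρ a ↔
      ∃ ρ' : ℕ → ℕ, (∀ r ∉ L, ρ' r = ρ r) ∧ (∀ r ∈ L, ρ' r < N) ∧ row ∈ f ρ' a := by
  induction L generalizing ρ with
  | nil =>
    simp only [nestTables, List.not_mem_nil, not_false_eq_true, forall_const, false_imp_iff,
      true_and]
    exact ⟨fun h => ⟨ρ, fun _ => rfl, h⟩, fun ⟨ρ', h, h'⟩ => funext h ▸ h'⟩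
  | cons r L ih =>
    simp only [nestTables, List.mem_flatMap, List.mem_range, ih, List.mem_cons, not_or]
    constructor
    · rintro ⟨i, hi, ρ', h1, h2, h3⟩
      refine ⟨ρ', fun r' hr' => ?_, ?_, h3⟩
      · rw [h1 r' hr'.2, Function.update_of_ne hr'.1]
      · rintro r' (rfl | hr')
        · by_cases hL : r' ∈ L
          · exact h2 _ hL
          · rw [h1 _ hL]; simpa using hi
        · exact h2 _ hr'
    · rintro ⟨ρ', h1, h2, h3⟩
      refine ⟨ρ' r, h2 r (.inl rfl), ρ', fun r' hr' => ?_, fun r' hr' => h2 r' (.inr hr'), h3⟩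
      by_cases h : r' = r
      · subst h; simp
      · rw [Function.update_of_ne h, h1 r' ⟨h, hr'⟩]

/-- Listed relations must be free of repetitions, and the program has no memory to detect them; it
suffices that an emitted row determines the loop registers. -/
theorem nodup_nestTables {N : ℕ} {f : (ℕ → ℕ) → Tables} {L : List ℕ} {ρ : ℕ → ℕ} {a : ℕ}
    (hL : L.Nodup) (hf : ∀ ρ, (f ρ a).Nodup)
    (hinj : ∀ ρ₁ ρ₂ : ℕ → ℕ, (∀ r ∉ L, ρ₁ r = ρ r) → (∀ r ∉ L, ρ₂ r = ρ r) →
      (∀ r ∈ L, ρ₁ r < N) → (∀ r ∈ L, ρ₂ r < N) →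
      ∀ row, row ∈ f ρ₁ a → row ∈ f ρ₂ a → ∀ r ∈ L, ρ₁ r = ρ₂ r) :
    (nestTables N f L ρ a).Nodup := by
  induction L generalizing ρ with
  | nil => exact hf ρ
  | cons r L ih =>
    rw [List.nodup_cons] at hL
    have hout : ∀ {i : ℕ} {ρ' : ℕ → ℕ}, (∀ r' ∉ L, ρ' r' = Function.update ρ r i r') →
        ∀ r' ∉ r :: L, ρ' r' = ρ r' := fun h r' hr' => by
      rw [List.mem_cons, not_or] at hr'
      rw [h r' hr'.2, Function.update_of_ne hr'.1]
    have hin : ∀ {i : ℕ} {ρ' : ℕ → ℕ}, i < N → (∀ r' ∉ L, ρ' r' = Function.update ρ r i r') →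
        (∀ r' ∈ L, ρ' r' < N) → ∀ r' ∈ r :: L, ρ' r' < N := fun hi h h' r' hr' => by
      rcases List.mem_cons.1 hr' with rfl | hr'
      · rw [h _ hL.1]; simpa using hi
      · exact h' r' hr'
    simp only [nestTables]
    rw [List.nodup_flatMap]
    constructor
    · intro i hi
      rw [List.mem_range] at hi
      exact ih hL.2 fun ρ₁ ρ₂ h₁ h₂ g₁ g₂ row m₁ m₂ r' hr' =>
        hinj ρ₁ ρ₂ (hout h₁) (hout h₂) (hin hi h₁ g₁) (hin hi h₂ g₂) row m₁ m₂ r'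
          (List.mem_cons_of_mem _ hr')
    · refine (List.nodup_range (n := N)).pairwise_of_forall_ne fun i hi j hj hij => ?_
      rw [List.mem_range] at hi hj
      intro row m₁ m₂
      obtain ⟨ρ₁, h₁, g₁, e₁⟩ := mem_nestTables.1 m₁
      obtain ⟨ρ₂, h₂, g₂, e₂⟩ := mem_nestTables.1 m₂
      have := hinj ρ₁ ρ₂ (hout h₁) (hout h₂) (hin hi h₁ g₁) (hin hj h₂ g₂) row e₁ e₂ r
        (by simp)
      rw [h₁ r hL.1, h₂ r hL.1] at this
      exact hij (by simpa using this)

/-- Run the programs `p i` for all `i` in the list. -/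
def seqList {ι : Type*} (p : ι → Prog) (l : List ι) : Prog :=
  l.foldr (fun i q => .seq (p i) q) .skip

theorem elementary_seqList {ι : Type*} {p : ι → Prog} (hp : ∀ i, (p i).Elementary) (l : List ι) :
    (seqList p l).Elementary := by
  induction l with
  | nil => trivial
  | cons i l ih => exact ⟨hp i, ih⟩

theorem Emits.seqList {ι : Type*} {p : ι → Prog} {f : ι → Tables} {T : ι → ℕ}
    (hp : ∀ i, (p i).Emits W s (f i) (T i)) (l : List ι) :
    (seqList p l).Emits W s (fun a => l.flatMap fun i => f i a) ((l.map T).sum + 1) := by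
  induction l with
  | nil => simpa [Prog.seqList] using emits_skip
  | cons i l ih =>
    have := (hp i).seq ih
    simpa [Prog.seqList, add_assoc] using this

end Prog

/-! ## Arithmetic expressions -/

namespace Expr

variable {W : ℕ} {s : State}

/-- The power `N ^ i` of the number `N` of rows of input table `0`. -/
def power : ℕ → Expr
  | 0 => const 1
  | i + 1 => mul (power i) (inpLen 0)

theorem eval_power (i : ℕ) : (power i).eval s = (s.inp 0).length ^ i := by
  induction i with
  | zero => rfl
  | succ i ih => simp [power, eval, ih, pow_succ]

theorem fits_power {i : ℕ} (h : ((s.inp 0).length + 2) ^ i ≤ W) (h' : (s.inp 0).length ≤ W) :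
    (power i).Fits W s := by
  induction i with
  | zero => simpa [power, Fits] using h
  | succ i ih =>
    refine ⟨ih ((Nat.pow_le_pow_right (by omega) i.le_succ).trans h), h', ?_⟩
    rw [eval_power]
    change _ * (s.inp 0).length ≤ W
    rw [← pow_succ]
    exact (Nat.pow_le_pow_left (by omega) _).trans h

def sum (l : List Expr) : Expr := l.foldr add (const 0)

theorem eval_sum (l : List Expr) : (sum l).eval s = (l.map fun e => e.eval s).sum := by
  induction l with
  | nil => rfl
  | cons e l ih => simpa [sum, eval] using ih

theorem fits_sum {l : List Expr} (hl : ∀ e ∈ l, e.Fits W s)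
    (h : (l.map fun e => e.eval s).sum ≤ W) : (sum l).Fits W s := by
  induction l with
  | nil => exact Nat.zero_le _
  | cons e l ih =>
    simp only [List.map_cons, List.sum_cons] at h
    refine ⟨hl e (by simp), ih (fun e' he' => hl e' (by simp [he'])) (by omega), ?_⟩
    change e.eval s + (sum l).eval s ≤ W
    rwa [eval_sum]

/-- The digit of `e` with index `i` to the base `N`, the number of rows of input table `0`. -/
def digit (i : ℕ) (e : Expr) : Expr :=
  sub (div e (power i)) (mul (div (div e (power i)) (inpLen 0)) (inpLen 0))

/-- The machine has no remainder operation, so the remainder is computed as `q - (q / N) * N`. -/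
theorem eval_digit (i : ℕ) (e : Expr) :
    (digit i e).eval s = e.eval s / (s.inp 0).length ^ i % (s.inp 0).length := by
  simp only [digit, eval, eval_power]
  rw [Nat.mod_eq_sub_mul_div, mul_comm]

theorem fits_digit {i : ℕ} {e : Expr} (he : e.Fits W s) (heW : e.eval s ≤ W)
    (h : ((s.inp 0).length + 2) ^ i ≤ W) (h' : (s.inp 0).length ≤ W) : (digit i e).Fits W s := by
  have hp := fits_power h h'
  refine ⟨⟨he, hp⟩, ⟨⟨he, hp⟩, h'⟩, h', ?_⟩
  simp only [eval]
  exact (Nat.div_mul_le_self _ _).trans ((Nat.div_le_self _ _).trans heW)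

end Expr

/-! ## Rows of tuples -/

section Rows

variable {n : ℕ} {J : Finset (Fin n)}

/-- The position of a variable in the rows of a relation with schema `J`. -/
def rowIndex (v : J) : ℕ := ((Finset.univ : Finset J).sort (· ≤ ·)).idxOf v

theorem rowIndex_lt (v : J) : rowIndex v < ((Finset.univ : Finset J).sort (· ≤ ·)).length :=
  List.idxOf_lt_length_of_mem (by simp)

theorem rowIndex_le (v : J) : rowIndex v ≤ n := by
  have h := rowIndex_lt v
  rw [Finset.length_sort, Finset.card_univ, Fintype.card_coe] at h
  exact h.le.trans ((Finset.card_le_univ J).trans_eq (Fintype.card_fin n))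

theorem getD_rowOf (t : J → ℕ) (v : J) : (rowOf t).getD (rowIndex v) 0 = t v := by
  have h := rowIndex_lt v
  rw [rowOf, List.getD_eq_getElem _ _ (by simpa using h), List.getElem_map]
  exact congrArg t (List.getElem_idxOf h)

theorem rowOf_injective : Function.Injective (rowOf (J := J)) := fun t t' h =>
  funext fun v => by rw [← getD_rowOf t, h, getD_rowOf]

theorem Table.Lists.length_le {T : Table} {S : Set (J → ℕ)} (h : T.Lists S) (hS : S.Finite) :
    T.length ≤ S.ncard := by
  classical
  rw [← List.toFinset_card_of_nodup h.1, ← Set.ncard_image_of_injective S rowOf_injective,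
    ← Set.ncard_coe_finset]
  refine Set.ncard_le_ncard ?_ (hS.image _)
  intro row hrow
  obtain ⟨t, ht, rfl⟩ := (h.2 row).1 (by simpa using hrow)
  exact ⟨t, ht, rfl⟩

theorem CQ.Database.exists_encodedBy {Q : CQ} (D : Q.Database) : ∃ T, D.EncodedBy T := by
  refine ⟨fun a => if h : a < Q.m then (D ⟨a, h⟩).toList.map rowOf else [], fun j => ?_, fun a ha =>
    dif_neg (by omega)⟩
  simp only [j.2, dif_pos, Fin.eta]
  refine ⟨(Finset.nodup_toList _).map rowOf_injective, fun row => ?_⟩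
  simp [eq_comm]

end Rows

/-- A set that is parametrized by maps `A → {0, …, N - 1}` has at most `N ^ |A|` elements. -/
theorem ncard_image_le_pow {k N : ℕ} {β : Type*} (A : Finset (Fin k)) (F : (ℕ → ℕ) → β)
    (hF : ∀ ρ ρ' : ℕ → ℕ, (∀ i ∈ A, ρ i = ρ' i) → F ρ = F ρ') :
    (F '' {ρ | ∀ i ∈ A, ρ i < N}).Finite ∧
      (F '' {ρ | ∀ i ∈ A, ρ i < N}).ncard ≤ N ^ A.card := by
  classical
  -- Extension of a map on `A` by zero; `F` does not see the values outside `A`.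
  let e : (A → Fin N) → ℕ → ℕ := fun g r =>
    if h : ∃ i : A, (i : Fin k).val = r then g h.choose else 0
  have hsub : F '' {ρ | ∀ i ∈ A, ρ i < N} ⊆ Set.range fun g => F (e g) := by
    rintro _ ⟨ρ, hρ, rfl⟩
    refine ⟨fun i => ⟨ρ i, hρ i i.2⟩, hF _ _ fun i hi => ?_⟩
    have h : ∃ i' : A, (i' : Fin k).val = i := ⟨⟨i, hi⟩, rfl⟩
    simp only [e, dif_pos h]
    rw [h.choose_spec]
  refine ⟨(Set.finite_range _).subset hsub, (Set.ncard_le_ncard hsub (Set.finite_range _)).trans ?_⟩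
  rw [← Set.image_univ]
  refine (Set.ncard_image_le Set.finite_univ).trans ?_
  simp [Set.ncard_univ]

/-! ## Codes of partial maps -/

section Code

variable {n k : ℕ} (ψ : Fin k → Finset (Fin n))

/-- The digits to the base `N` of the constant for the variable `v` are the values `ρ i` for the
indices `i` with `v ∈ ψ i`. -/
def code (N : ℕ) (ρ : ℕ → ℕ) (v : Fin n) : ℕ :=
  ∑ i : Fin k, if v ∈ ψ i then ρ i * N ^ (i : ℕ) else 0

variable {ψ}

theorem code_congr {N : ℕ} {ρ ρ' : ℕ → ℕ} {v : Fin n} (h : ∀ i : Fin k, v ∈ ψ i → ρ i = ρ' i) :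
    code ψ N ρ v = code ψ N ρ' v :=
  Finset.sum_congr rfl fun i _ => by
    by_cases hi : v ∈ ψ i
    · rw [h i hi]
    · simp [hi]

/-- The code is a base-`N` expansion with digits below `N`, so uniqueness of expansions, in the form
of `finFunctionFinEquiv`, recovers each digit. -/
theorem digit_code {N : ℕ} {ρ : ℕ → ℕ} {v : Fin n} (hρ : ∀ i : Fin k, v ∈ ψ i → ρ i < N)
    {i : Fin k} (hi : v ∈ ψ i) : code ψ N ρ v / N ^ (i : ℕ) % N = ρ i := by
  have hN : 0 < N := (Nat.zero_le _).trans_lt (hρ i hi)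
  -- Positions `j` with `v ∉ ψ j` carry the digit `0`.
  let f : Fin k → Fin N := fun j => if h : v ∈ ψ j then ⟨ρ j, hρ j h⟩ else ⟨0, hN⟩
  have h1 : code ψ N ρ v = (finFunctionFinEquiv f : ℕ) := by
    rw [finFunctionFinEquiv_apply]
    refine Finset.sum_congr rfl fun j _ => ?_
    by_cases h : v ∈ ψ j <;> simp [f, h]
  have h2 := congrArg Fin.val (congrFun (finFunctionFinEquiv.symm_apply_apply f) i)
  rw [finFunctionFinEquiv_symm_apply_val, ← h1] at h2
  simpa [f, hi] using h2

/-- There are `k ≤ (N + 2) ^ k` summands, each at most `(N + 2) ^ k`. The base `N + 2` keeps the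
powers monotone for `N = 0`. -/
theorem code_le {N : ℕ} {ρ : ℕ → ℕ} {v : Fin n} (hρ : ∀ i : Fin k, v ∈ ψ i → ρ i ≤ N) :
    code ψ N ρ v ≤ (N + 2) ^ (2 * k) := by
  have h : code ψ N ρ v ≤ ∑ _i : Fin k, (N + 2) ^ k := by
    refine Finset.sum_le_sum fun i _ => ?_
    by_cases hi : v ∈ ψ i
    · rw [if_pos hi]
      calc ρ i * N ^ (i : ℕ) ≤ (N + 2) * (N + 2) ^ (i : ℕ) :=
            Nat.mul_le_mul ((hρ i hi).trans (by omega)) (Nat.pow_le_pow_left (by omega) _)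
        _ = (N + 2) ^ ((i : ℕ) + 1) := (pow_succ' _ _).symm
        _ ≤ (N + 2) ^ k := Nat.pow_le_pow_right (by omega) i.2
    · simp [hi]
  refine h.trans ?_
  rw [Finset.sum_const, Finset.card_univ, Fintype.card_fin, smul_eq_mul, two_mul, pow_add]
  exact Nat.mul_le_mul_right _
    (Nat.lt_two_pow_self.le.trans (Nat.pow_le_pow_left (by omega) _))

variable (ψ)

def codeExpr (v : Fin n) : Expr :=
  Expr.sum ((List.finRange k).map fun i =>
    if v ∈ ψ i then Expr.mul (.reg i) (Expr.power i) else .const 0)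

variable {ψ} {W : ℕ} {s : State}

theorem map_eval_codeExpr (v : Fin n) :
    (((List.finRange k).map fun i : Fin k =>
      if v ∈ ψ i then Expr.mul (.reg i) (Expr.power i) else .const 0).map fun e => e.eval s).sum =
      code ψ (s.inp 0).length s.reg v := by
  rw [code, Fin.sum_univ_def, List.map_map]
  congr 2
  funext i
  by_cases hi : v ∈ ψ i <;> simp [hi, Expr.eval, Expr.eval_power]

theorem eval_codeExpr (v : Fin n) :
    (codeExpr ψ v).eval s = code ψ (s.inp 0).length s.reg v := by
  rw [codeExpr, Expr.eval_sum, map_eval_codeExpr]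

theorem fits_codeExpr {v : Fin n} (hW : ((s.inp 0).length + 2) ^ (2 * k) ≤ W)
    (hs : ∀ r, s.reg r ≤ (s.inp 0).length) : (codeExpr ψ v).Fits W s := by
  refine Expr.fits_sum ?_ ?_
  · intro e he
    obtain ⟨i, -, rfl⟩ := List.mem_map.1 he
    have hNW : (s.inp 0).length ≤ W := by
      refine le_trans ?_ hW
      calc (s.inp 0).length ≤ ((s.inp 0).length + 2) ^ 1 := by simp
        _ ≤ _ := Nat.pow_le_pow_right (by omega) (by have := i.2; omega)
    by_cases hi : v ∈ ψ i
    · rw [if_pos hi]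
      refine ⟨(hs i).trans hNW, Expr.fits_power (le_trans ?_ hW) hNW, ?_⟩
      · exact Nat.pow_le_pow_right (by omega) (by have := i.2; omega)
      · rw [Expr.eval_power]
        change s.reg i * _ ≤ W
        calc s.reg i * (s.inp 0).length ^ (i : ℕ)
            ≤ ((s.inp 0).length + 2) * ((s.inp 0).length + 2) ^ (i : ℕ) :=
              Nat.mul_le_mul ((hs i).trans (by omega)) (Nat.pow_le_pow_left (by omega) _)
          _ = ((s.inp 0).length + 2) ^ ((i : ℕ) + 1) := (pow_succ' _ _).symm
          _ ≤ ((s.inp 0).length + 2) ^ (2 * k) :=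
              Nat.pow_le_pow_right (by omega) (by have := i.2; omega)
          _ ≤ W := hW
    · rw [if_neg hi]
      exact Nat.zero_le _
  · rw [map_eval_codeExpr]
    exact (code_le fun i _ => hs i).trans hW

end Code

/-! ## The database of a graph -/

section Database

variable {n k : ℕ} (ψ : Fin k → Finset (Fin n))

/-- The indices `i` such that `ψ i` meets `J`. -/
def metBy (J : Finset (Fin n)) : Finset (Fin k) :=
  Finset.univ.filter fun i => (ψ i ∩ J).Nonempty

variable {ψ}

theorem mem_metBy {J : Finset (Fin n)} {i : Fin k} {v : Fin n} (hv : v ∈ J) (hi : v ∈ ψ i) :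
    i ∈ metBy ψ J := by
  simpa [metBy] using ⟨v, Finset.mem_inter.2 ⟨hi, hv⟩⟩

variable (ψ)

/-- The tuples over `J` that code a clique, indexed by `metBy ψ J`, of the graph with adjacency
matrix `Γ`. -/
def cliqueRel (Γ : Table) (J : Finset (Fin n)) : Set (J → ℕ) :=
  {t | ∃ ρ : ℕ → ℕ, (∀ i ∈ metBy ψ J, ρ i < Γ.length) ∧
    (∀ i ∈ metBy ψ J, ∀ j ∈ metBy ψ J, i ≠ j → 1 ≤ Γ.cell (ρ i) (ρ j)) ∧
    t = fun v : J => code ψ Γ.length ρ v}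

/-- A tuple over `J` depends only on the vertices chosen for the indices in `metBy ψ J`. -/
theorem cliqueRel_finite_ncard (Γ : Table) (J : Finset (Fin n)) :
    (cliqueRel ψ Γ J).Finite ∧ (cliqueRel ψ Γ J).ncard ≤ Γ.length ^ weakEdgeDepth ψ J := by
  have h := ncard_image_le_pow (N := Γ.length) (metBy ψ J)
    (fun ρ (v : J) => code ψ Γ.length ρ v)
    fun ρ ρ' h => funext fun v => code_congr fun i hi => h i (mem_metBy v.2 hi)
  have hsub : cliqueRel ψ Γ J ⊆ (fun ρ (v : J) => code ψ Γ.length ρ v) ''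
      {ρ : ℕ → ℕ | ∀ i ∈ metBy ψ J, ρ i < Γ.length} := by
    rintro t ⟨ρ, hρ, -, rfl⟩
    exact ⟨ρ, hρ, rfl⟩
  exact ⟨h.1.subset hsub, (Set.ncard_le_ncard hsub h.1).trans h.2⟩

noncomputable def loopRegs (J : Finset (Fin n)) : List ℕ := (metBy ψ J).toList.map Fin.val

noncomputable def adjacencyTests (J : Finset (Fin n)) : List (Expr × Expr) :=
  ((metBy ψ J ×ˢ metBy ψ J).filter fun p => p.1 ≠ p.2).toList.map fun p =>
    (.const 1, .inp 0 (.reg p.1) (.reg p.2))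

/-- Emit the relation `cliqueRel` for `J` to table `a`. -/
noncomputable def emitCliques (J : Finset (Fin n)) (a : ℕ) : Prog :=
  Prog.nest (loopRegs ψ J) (Prog.guards (adjacencyTests ψ J)
    (.emit a (((Finset.univ : Finset J).sort (· ≤ ·)).map fun v : J => codeExpr ψ v)))

theorem elementary_emitCliques (J : Finset (Fin n)) (a : ℕ) : (emitCliques ψ J a).Elementary :=
  .nest (.guards (p := .emit _ _) trivial _) _

/-- Brute force over all vertex choices for the indices met by `J`, with register `i` holding the
choice for index `i`. The constant depends only on `ψ` and `J`. -/
theorem emits_emitCliques (J : Finset (Fin n)) (a : ℕ) : ∃ C : ℕ, ∀ (W : ℕ) (s : State),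
    0 < k → ((s.inp 0).length + 2) ^ (2 * k) ≤ W → (∀ i j, (s.inp 0).cell i j ≤ 1) →
    (∀ r, s.reg r = 0) →
    ∃ f : Tables, (emitCliques ψ J a).Emits W s f
        (C * (max 1 (s.inp 0).length) ^ weakEdgeDepth ψ J) ∧
      (f a).Lists (cliqueRel ψ (s.inp 0) J) ∧ ∀ b ≠ a, f b = [] := by
  set es : List Expr := ((Finset.univ : Finset J).sort (· ≤ ·)).map fun v : J => codeExpr ψ v with hes
  refine ⟨Prog.guardsCost (adjacencyTests ψ J) + ((es.map Expr.cost).sum + 1) +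
    3 * (loopRegs ψ J).length, fun W s hk hW hcell hreg => ?_⟩
  have hlen : (loopRegs ψ J).length = weakEdgeDepth ψ J := by
    simp [loopRegs, metBy, weakEdgeDepth]
  have hmem : ∀ r, r ∈ loopRegs ψ J ↔ ∃ i ∈ metBy ψ J, (i : ℕ) = r := by simp [loopRegs]
  have hnodup : (loopRegs ψ J).Nodup := (Finset.nodup_toList _).map Fin.val_injective
  obtain ⟨N, hN⟩ : ∃ N, (s.inp 0).length = N := ⟨_, rfl⟩
  have hNW : N ≤ W := by
    refine le_trans ?_ hW
    rw [hN]
    calc N ≤ (N + 2) ^ 1 := by simp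
      _ ≤ _ := Nat.pow_le_pow_right (by omega) (by omega)
  have h1W : 1 ≤ W := (Nat.one_le_pow _ _ (by omega)).trans hW
  let body : (ℕ → ℕ) → Tables := fun ρ b =>
    if ∀ ef ∈ adjacencyTests ψ J,
      ef.1.eval { s with reg := ρ } ≤ ef.2.eval { s with reg := ρ } then
      if b = a then [es.map fun e => e.eval { s with reg := ρ }] else []
    else []
  have hrow : ∀ ρ : ℕ → ℕ, (es.map fun e => e.eval { s with reg := ρ }) =
      rowOf fun v : J => code ψ N ρ v := by
    intro ρ
    rw [hes, rowOf, List.map_map]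
    refine List.map_congr_left fun v _ => ?_
    simp only [Function.comp_apply, eval_codeExpr]
    rw [hN]
  have hbody : ∀ ρ row, row ∈ body ρ a ↔
      (∀ i ∈ metBy ψ J, ∀ j ∈ metBy ψ J, i ≠ j → 1 ≤ (s.inp 0).cell (ρ i) (ρ j)) ∧
        row = rowOf fun v : J => code ψ N ρ v := by
    intro ρ row
    simp only [body, if_true, hrow]
    rw [List.mem_ite_nil_right, List.mem_singleton]
    refine and_congr_left fun _ => ?_
    simp only [adjacencyTests, List.mem_map, Finset.mem_toList, Finset.mem_filter,
      Finset.mem_product, Prod.exists, forall_exists_index, and_imp]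
    constructor
    · intro h i hi j hj hij
      exact h _ i j hi hj hij rfl
    · rintro h ef i j hi hj hij rfl
      exact h i hi j hj hij
  refine ⟨Prog.nestTables N body (loopRegs ψ J) s.reg, ?_, ⟨?_, ?_⟩, ?_⟩
  · have := Prog.Emits.nest (W := W) (s := s) (L := loopRegs ψ J) (f := body) hN hNW
      (fun r => by simp [hreg]) (fun ρ hρ => Prog.Emits.guards (c := adjacencyTests ψ J) ?_
        (Prog.emits_emit a es ?_))
    · rw [hlen] at this ⊢
      rw [hN]
      exact this
    · intro ef hef
      obtain ⟨p, -, rfl⟩ := List.mem_map.1 hef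
      exact ⟨h1W, (hρ _).trans hNW, (hρ _).trans hNW, (hcell _ _).trans h1W⟩
    · intro e he
      obtain ⟨v, -, rfl⟩ := List.mem_map.1 he
      exact fits_codeExpr hW fun r => (hρ r).trans_eq hN.symm
  · refine Prog.nodup_nestTables hnodup (fun ρ => ?_) ?_
    · simp only [body]
      split_ifs <;> simp
    · intro ρ₁ ρ₂ _ _ g₁ g₂ row m₁ m₂ r hr
      obtain ⟨i, hi, rfl⟩ := (hmem r).1 hr
      -- No repetitions: as `J` meets `ψ i` in some `v`, the entry at `v` reveals the content of
      -- register `i`.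
      obtain ⟨v, hv⟩ := (Finset.mem_filter.1 hi).2
      rw [Finset.mem_inter] at hv
      have heq := congrFun (rowOf_injective
        (((hbody ρ₁ row).1 m₁).2.symm.trans ((hbody ρ₂ row).1 m₂).2)) ⟨v, hv.2⟩
      have hlt : ∀ {ρ : ℕ → ℕ}, (∀ r ∈ loopRegs ψ J, ρ r < N) →
          ∀ i : Fin k, v ∈ ψ i → ρ i < N := fun g j hj =>
        g j ((hmem _).2 ⟨j, mem_metBy hv.2 hj, rfl⟩)
      rw [← digit_code (hlt g₁) hv.1, ← digit_code (hlt g₂) hv.1]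
      exact congrArg (fun c => c / N ^ (i : ℕ) % N) heq
  · intro row
    rw [Prog.mem_nestTables]
    constructor
    · rintro ⟨ρ, -, hρ, hm⟩
      obtain ⟨hadj, rfl⟩ := (hbody ρ row).1 hm
      exact ⟨_, ⟨ρ, fun i hi => hN ▸ hρ i ((hmem _).2 ⟨i, hi, rfl⟩), hadj, rfl⟩, by rw [hN]⟩
    · rintro ⟨t, ⟨ρ, hρ, hadj, rfl⟩, rfl⟩
      -- The loops leave the other registers alone, so `ρ` is reset there; neither the tests nor the
      -- codes look at them.
      refine ⟨fun r => if r ∈ loopRegs ψ J then ρ r else s.reg r, fun r hr => by simp [hr],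
        fun r hr => ?_, (hbody _ _).2 ⟨fun i hi j hj hij => ?_, ?_⟩⟩
      · obtain ⟨i, hi, rfl⟩ := (hmem r).1 hr
        simpa [hr, ← hN] using hρ i hi
      · simpa [(hmem _).2 ⟨i, hi, rfl⟩, (hmem _).2 ⟨j, hj, rfl⟩] using hadj i hi j hj hij
      · rw [hN]
        congr 1
        funext v
        refine code_congr fun i hi => ?_
        simp [(hmem _).2 ⟨i, mem_metBy v.2 hi, rfl⟩]
  · intro b hb
    rw [List.eq_nil_iff_forall_not_mem]
    intro row hrow
    obtain ⟨ρ, -, -, hm⟩ := Prog.mem_nestTables.1 hrow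
    simp [body, hb] at hm

end Database

/-! ## Cliques from consistent digits -/

/-- Read `d v i` as the vertex that `v` proposes for `i`. Consecutive vertices of a walk in `ψ i`
share a hyperedge, so the proposal is constant on `ψ i`. Two sets that touch have members in a
common hyperedge, where `hR` applies; if they intersect, any hyperedge through a common vertex
serves. -/
theorem IsCliqueEmbedding.exists_clique {V : Type*} [DecidableEq V] {E : Set (Finset V)} {k : ℕ}
    {ψ : Fin k → Finset V} (hψ : IsCliqueEmbedding E k ψ) (hE : ∀ v, ∃ e ∈ E, v ∈ e)
    (d : V → Fin k → ℕ) (R : ℕ → ℕ → Prop)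
    (heq : ∀ e ∈ E, ∀ u ∈ e, ∀ v ∈ e, ∀ i, u ∈ ψ i → v ∈ ψ i → d u i = d v i)
    (hR : ∀ e ∈ E, ∀ u ∈ e, ∀ v ∈ e, ∀ i j, i ≠ j → u ∈ ψ i → v ∈ ψ j → R (d u i) (d v j)) :
    ∃ a : Fin k → ℕ, ∀ i j, i ≠ j → R (a i) (a j) := by
  choose r hr using hψ.nonempty
  have hconst : ∀ i, ∀ v ∈ ψ i, d v i = d (r i) i := by
    intro i v hv
    obtain ⟨w⟩ := (hψ.connected i).preconnected ⟨v, hv⟩ ⟨r i, hr i⟩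
    have key : ∀ x y : (ψ i : Set V), ((primalGraph E).induce (ψ i : Set V)).Walk x y →
        d x i = d y i := by
      intro x y w
      induction w with
      | nil => rfl
      | @cons x y z h _ ih =>
        obtain ⟨-, e, he, hx, hy⟩ := h
        exact (heq e he _ hx _ hy i x.2 y.2).trans ih
    exact key _ _ w
  refine ⟨fun i => d (r i) i, fun i j hij => ?_⟩
  beta_reduce
  rcases hψ.touch i j hij with ⟨v, hv⟩ | ⟨e, he, ⟨u, hu⟩, ⟨v, hv⟩⟩
  · rw [Finset.mem_inter] at hv
    obtain ⟨e, he, hve⟩ := hE v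
    rw [← hconst i v hv.1, ← hconst j v hv.2]
    exact hR e he v hve v hve i j hij hv.1 hv.2
  · rw [Finset.mem_inter] at hu hv
    rw [← hconst i u hu.2, ← hconst j v hv.2]
    exact hR e he u hu.1 v hv.1 i j hij hu.2 hv.2

section Consistency

variable {n k : ℕ} (ψ : Fin k → Finset (Fin n))

/-- The digits of `t` agree where they have the same index, and are adjacent in the graph with
adjacency matrix `Γ` where they have different indices. -/
def DigitsConsistent (Γ : Table) {J : Finset (Fin n)} (t : J → ℕ) : Prop :=
  ∀ (i j : Fin k) (u v : J), (u : Fin n) ∈ ψ i → (v : Fin n) ∈ ψ j →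
    if i = j then t u / Γ.length ^ (i : ℕ) % Γ.length ≤ t v / Γ.length ^ (j : ℕ) % Γ.length
    else 1 ≤ Γ.cell (t u / Γ.length ^ (i : ℕ) % Γ.length) (t v / Γ.length ^ (j : ℕ) % Γ.length)

variable {ψ}

/-- Used in both directions: for the tuples of the atoms, and for the answer that a clique of the
graph produces. -/
theorem digitsConsistent_code {Γ : Table} {J : Finset (Fin n)} {ρ : ℕ → ℕ}
    (hρ : ∀ i ∈ metBy ψ J, ρ i < Γ.length)
    (hadj : ∀ i ∈ metBy ψ J, ∀ j ∈ metBy ψ J, i ≠ j → 1 ≤ Γ.cell (ρ i) (ρ j)) :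
    DigitsConsistent ψ Γ fun v : J => code ψ Γ.length ρ v := by
  intro i j u v hu hv
  have hd : ∀ (i : Fin k) (u : J), (u : Fin n) ∈ ψ i →
      code ψ Γ.length ρ u / Γ.length ^ (i : ℕ) % Γ.length = ρ i := fun i u hu =>
    digit_code (fun j hj => hρ j (mem_metBy u.2 hj)) hu
  rw [hd i u hu, hd j v hv]
  split_ifs with h
  · rw [h]
  · exact hadj i (mem_metBy u.2 hu) j (mem_metBy v.2 hv) h

variable (ψ) (J : Finset (Fin n))

def digitExpr (i : Fin k) (v : J) : Expr :=
  Expr.digit i (.res 0 (.reg 0) (.const (rowIndex v)))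

open Classical in
noncomputable def consistencyTests : List (Expr × Expr) :=
  ((Finset.univ : Finset ((Fin k × J) × (Fin k × J))).filter fun q =>
    (q.1.2 : Fin n) ∈ ψ q.1.1 ∧ (q.2.2 : Fin n) ∈ ψ q.2.1).toList.map fun q =>
      if q.1.1 = q.2.1 then (digitExpr J q.1.1 q.1.2, digitExpr J q.2.1 q.2.2)
      else (.const 1, .inp 0 (digitExpr J q.1.1 q.1.2) (digitExpr J q.2.1 q.2.2))

/-- Emit a row for every tuple with consistent digits in result table `0`. -/
noncomputable def emitConsistent : Prog :=
  .loop 0 (.resLen 0) (Prog.guards (consistencyTests ψ J) (.emit 0 []))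

theorem elementary_emitConsistent : (emitConsistent ψ J).Elementary :=
  Prog.Elementary.guards (p := .emit _ _) trivial _

/-- For fixed `ψ` and `J` a row undergoes a bounded number of tests, so the cost is linear in the
number of rows. The emitted rows are empty lists; only their presence matters. -/
theorem emits_emitConsistent : ∃ C : ℕ, ∀ (W : ℕ) (s : State) (S : Set (J → ℕ)),
    (s.res 0).Lists S → (s.res 0).length ≤ W → n ≤ W → 1 ≤ W → (s.inp 0).length ≤ W →
    ((s.inp 0).length + 2) ^ k ≤ W → (∀ i j, (s.inp 0).cell i j ≤ 1) →
    (∀ t ∈ S, ∀ v, t v ≤ W) →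
    ∃ f : Tables, (emitConsistent ψ J).Emits W s f (C * ((s.res 0).length + 1)) ∧
      (f 0 ≠ [] ↔ ∃ t ∈ S, DigitsConsistent ψ (s.inp 0) t) := by
  refine ⟨2 + (Prog.guardsCost (consistencyTests ψ J) + 1 + 1),
    fun W s S hS hlen hn h1 hN hNk hcell hSW => ?_⟩
  have hrow : ∀ r < (s.res 0).length, ∃ t ∈ S, (s.res 0).getD r [] = rowOf t := by
    intro r hr
    rw [List.getD_eq_getElem _ _ hr]
    exact (hS.2 _).1 (List.getElem_mem hr)
  have hres : ∀ (r : ℕ) (t : J → ℕ), (s.res 0).getD r [] = rowOf t → ∀ v : J,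
      (Expr.res 0 (.reg 0) (.const (rowIndex v))).eval
        { s with reg := Function.update s.reg 0 r } = t v := by
    intro r t ht v
    simp only [Expr.eval, Table.cell, Function.update_self, ht, getD_rowOf]
  have hdig : ∀ (r : ℕ) (t : J → ℕ), (s.res 0).getD r [] = rowOf t → ∀ (i : Fin k) (v : J),
      (digitExpr J i v).eval { s with reg := Function.update s.reg 0 r } =
        t v / (s.inp 0).length ^ (i : ℕ) % (s.inp 0).length := by
    intro r t ht i v
    rw [digitExpr, Expr.eval_digit, hres r t ht]
  have hfit : ∀ r < (s.res 0).length, ∀ (i : Fin k) (v : J),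
      (digitExpr J i v).Fits W { s with reg := Function.update s.reg 0 r } := by
    intro r hr i v
    obtain ⟨t, ht, htr⟩ := hrow r hr
    have hv := hres r t htr v
    refine Expr.fits_digit ⟨?_, (rowIndex_le v).trans hn, ?_⟩ ?_ ?_ hN
    · simpa [Expr.Fits] using hr.le.trans hlen
    · exact (hv.trans_le (hSW t ht v) :)
    · exact hv.trans_le (hSW t ht v)
    · exact (Nat.pow_le_pow_right (by omega) i.2.le).trans hNk
  have hemit := Prog.Emits.loop (W := W) (s := s) (r := 0) (b := .resLen 0)
    (p := Prog.guards (consistencyTests ψ J) (.emit 0 [])) hlen fun r hr =>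
      Prog.Emits.guards (s := { s with reg := Function.update s.reg 0 r })
        (c := consistencyTests ψ J) (by
          intro ef hef
          obtain ⟨q, -, rfl⟩ := List.mem_map.1 hef
          split_ifs with hq
          · exact ⟨hfit r hr _ _, hfit r hr _ _⟩
          · exact ⟨h1, hfit r hr _ _, hfit r hr _ _, (hcell _ _).trans h1⟩)
        (Prog.emits_emit 0 [] (by simp))
  refine ⟨_, hemit.mono ?_, ?_⟩
  · simp only [Expr.cost, Expr.eval, List.map_nil, List.sum_nil, zero_add]
    nlinarith
  · have htests : ∀ (r : ℕ) (t : J → ℕ), (s.res 0).getD r [] = rowOf t →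
        ((∀ ef ∈ consistencyTests ψ J,
          ef.1.eval { s with reg := Function.update s.reg 0 r } ≤
            ef.2.eval { s with reg := Function.update s.reg 0 r }) ↔
          DigitsConsistent ψ (s.inp 0) t) := by
      intro r t ht
      simp only [consistencyTests, List.mem_map, Finset.mem_toList, Finset.mem_filter,
        Finset.mem_univ, true_and, forall_exists_index, and_imp, DigitsConsistent]
      constructor
      · intro h i j u v hu hv
        have := h _ ((i, u), (j, v)) hu hv rfl
        by_cases hij : i = j
        · rw [if_pos hij] at this ⊢
          simpa only [hij, if_true, hdig r t ht] using this
        · rw [if_neg hij] at this ⊢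
          simpa only [hij, if_false, Expr.eval, hdig r t ht] using this
      · rintro h ef ⟨⟨i, u⟩, ⟨j, v⟩⟩ hu hv rfl
        have := h i j u v hu hv
        by_cases hij : i = j
        · rw [if_pos hij] at this ⊢
          simpa only [hij, if_true, hdig r t ht] using this
        · rw [if_neg hij] at this ⊢
          simpa only [hij, if_false, Expr.eval, hdig r t ht] using this
    rw [Ne, List.flatMap_eq_nil_iff, not_forall]
    simp only [List.mem_range, Expr.eval, if_true, List.map_nil, ite_eq_right_iff,
      List.cons_ne_nil, imp_false, Classical.not_imp, not_not]
    constructor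
    · rintro ⟨r, hr, h⟩
      obtain ⟨t, ht, htr⟩ := hrow r hr
      exact ⟨t, ht, (htests r t htr).1 h⟩
    · rintro ⟨t, ht, h⟩
      obtain ⟨r, hr, hrt⟩ := List.getElem_of_mem ((hS.2 _).2 ⟨t, ht, rfl⟩)
      refine ⟨r, hr, (htests r t ?_).2 h⟩
      rw [List.getD_eq_getElem _ _ hr, hrt]

end Consistency

/-! ## The reduction -/

theorem length_graphTables {n : ℕ} (G : SimpleGraph (Fin n)) : (graphTables G 0).length = n := by
  simp [graphTables]

theorem cell_graphTables {n : ℕ} (G : SimpleGraph (Fin n)) (a b : ℕ)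
    [Decidable (∃ (ha : a < n) (hb : b < n), G.Adj ⟨a, ha⟩ ⟨b, hb⟩)] :
    (graphTables G 0).cell a b =
      if ∃ (ha : a < n) (hb : b < n), G.Adj ⟨a, ha⟩ ⟨b, hb⟩ then 1 else 0 := by
  classical
  by_cases ha : a < n <;> by_cases hb : b < n <;>
    simp [graphTables, Table.cell, ha, hb, List.getD_eq_getElem?_getD]

theorem cell_graphTables_le {n : ℕ} (G : SimpleGraph (Fin n)) (a b : ℕ) :
    (graphTables G 0).cell a b ≤ 1 := by
  classical
  rw [cell_graphTables]
  split_ifs <;> simp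

theorem one_le_cell_graphTables {n : ℕ} (G : SimpleGraph (Fin n)) (a b : ℕ) :
    1 ≤ (graphTables G 0).cell a b ↔ ∃ (ha : a < n) (hb : b < n), G.Adj ⟨a, ha⟩ ⟨b, hb⟩ := by
  classical
  rw [cell_graphTables]
  split_ifs with h <;> simp [h]

/-- Cells outside the matrix read as `0`, so for `k ≥ 2` every `a i` is a vertex; injectivity comes
from the absence of loops. -/
theorem not_cliqueFree_iff_cell {n k : ℕ} (hk : 2 ≤ k) (G : SimpleGraph (Fin n)) :
    ¬ G.CliqueFree k ↔ ∃ a : Fin k → ℕ, ∀ i j, i ≠ j → 1 ≤ (graphTables G 0).cell (a i) (a j) := by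
  rw [SimpleGraph.not_cliqueFree_iff_top_isContained]
  constructor
  · rintro ⟨f⟩
    exact ⟨fun i => f i, fun i j hij =>
      (one_le_cell_graphTables G _ _).2 ⟨(f i).2, (f j).2, f.toHom.map_adj hij⟩⟩
  · rintro ⟨a, ha⟩
    simp only [one_le_cell_graphTables] at ha
    have hlt : ∀ i, a i < n := fun i => by
      have : Nontrivial (Fin k) := Fin.nontrivial_iff_two_le.2 hk
      obtain ⟨j, hj⟩ := exists_ne i
      exact (ha i j hj.symm).1
    have hadj : ∀ i j, i ≠ j → G.Adj ⟨a i, hlt i⟩ ⟨a j, hlt j⟩ := fun i j hij => (ha i j hij).2.2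
    refine ⟨⟨⟨fun i => ⟨a i, hlt i⟩, fun {i j} h => hadj i j h⟩, fun i j h => ?_⟩⟩
    by_contra hij
    exact G.ne_of_adj (hadj i j hij) h

/-! ### The clique database of a query: size, answers and correctness -/

namespace CQ

variable (Q : CQ) {k : ℕ} (ψ : Fin k → Finset (Fin Q.n))

noncomputable def cliqueDatabase (Γ : Table) : Q.Database := fun j =>
  (cliqueRel_finite_ncard ψ Γ (Q.schema j)).1.toFinset

variable {Q ψ}

theorem mem_cliqueDatabase {Γ : Table} {j : Fin Q.m} {t : Q.schema j → ℕ} :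
    t ∈ Q.cliqueDatabase ψ Γ j ↔ t ∈ cliqueRel ψ Γ (Q.schema j) :=
  Set.Finite.mem_toFinset _

theorem weakEdgeDepth_le_wed (j : Fin Q.m) : weakEdgeDepth ψ (Q.schema j) ≤ Q.wed ψ :=
  Finset.le_sup (f := fun j => weakEdgeDepth ψ (Q.schema j)) (Finset.mem_univ j)

theorem size_cliqueDatabase_le (Γ : Table) :
    (Q.cliqueDatabase ψ Γ).size ≤ Q.m * (max 1 Γ.length) ^ Q.wed ψ := by
  calc (Q.cliqueDatabase ψ Γ).size ≤ ∑ _j : Fin Q.m, (max 1 Γ.length) ^ Q.wed ψ := by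
        refine Finset.sum_le_sum fun j _ => ?_
        rw [cliqueDatabase, ← Set.ncard_eq_toFinset_card _ (cliqueRel_finite_ncard ψ Γ _).1]
        refine (cliqueRel_finite_ncard ψ Γ _).2.trans ?_
        exact (Nat.pow_le_pow_left (le_max_right _ _) _).trans
          (Nat.pow_le_pow_right (by simp) (weakEdgeDepth_le_wed j))
    _ = _ := by simp

theorem cliqueDatabase_valuesLE (Γ : Table) :
    (Q.cliqueDatabase ψ Γ).ValuesLE ((Γ.length + 2) ^ (2 * k)) := by
  intro j t ht v
  obtain ⟨ρ, hρ, -, rfl⟩ := mem_cliqueDatabase.1 ht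
  exact code_le fun i hi => (hρ i (mem_metBy v.2 hi)).le

/-- Each free variable lies in some atom. The choice `ρ` depends on that atom, so it may differ from
variable to variable. -/
theorem exists_code_of_mem_answer {Γ : Table} {t : Q.free → ℕ}
    (ht : t ∈ Q.answer (Q.cliqueDatabase ψ Γ)) (v : Q.free) :
    ∃ ρ : ℕ → ℕ, (∀ i : Fin k, (v : Fin Q.n) ∈ ψ i → ρ i < Γ.length) ∧
      t v = code ψ Γ.length ρ v := by
  obtain ⟨val, hval, rfl⟩ := ht
  obtain ⟨j, hj⟩ := Q.covers v
  obtain ⟨ρ, hρ, -, h⟩ := mem_cliqueDatabase.1 (hval j)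
  exact ⟨ρ, fun i hi => hρ i (mem_metBy hj hi), congrFun h ⟨v, hj⟩⟩

/-- The answers lie in a product over the free variables, where `v` contributes `n ^ |{i | v ∈ ψ
i}|` possible codes. -/
theorem outSize_cliqueDatabase_le (Γ : Table) :
    Q.outSize (Q.cliqueDatabase ψ Γ) ≤ Γ.length ^ edgeDepth ψ Q.free := by
  classical
  let A : Q.free → Finset (Fin k) := fun v => Finset.univ.filter fun i => (v : Fin Q.n) ∈ ψ i
  have hA := fun v : Q.free => ncard_image_le_pow (N := Γ.length) (A v)
    (fun ρ => code ψ Γ.length ρ v)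
    fun ρ ρ' h => code_congr fun i hi => h i (by simpa [A] using hi)
  let B := Fintype.piFinset fun v : Q.free => (hA v).1.toFinset
  have hsub : Q.answer (Q.cliqueDatabase ψ Γ) ⊆ B := by
    intro t ht
    simp only [B, Finset.mem_coe, Fintype.mem_piFinset, Set.Finite.mem_toFinset]
    intro v
    obtain ⟨ρ, hρ, h⟩ := exists_code_of_mem_answer ht v
    exact ⟨ρ, fun i hi => hρ i (by simpa [A] using hi), h.symm⟩
  refine (Set.ncard_le_ncard hsub B.finite_toSet).trans ?_
  rw [Set.ncard_coe_finset, Fintype.card_piFinset]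
  calc ∏ v : Q.free, (hA v).1.toFinset.card ≤ ∏ v : Q.free, Γ.length ^ (A v).card :=
        Finset.prod_le_prod' fun v _ => by
          rw [← Set.ncard_eq_toFinset_card _ (hA v).1]
          exact (hA v).2
    _ = Γ.length ^ ∑ v : Q.free, (A v).card := Finset.prod_pow_eq_pow_sum _ _ _
    _ = Γ.length ^ edgeDepth ψ Q.free := by
        rw [edgeDepth, ← Finset.sum_coe_sort Q.free]

/-- The atoms are consistent by construction and the free edge by the test, so all hyperedges of the
extended hypergraph are. Conversely, a clique codes a valuation that satisfies every atom and passes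
the test. -/
theorem exists_digitsConsistent_iff (hψ : IsCliqueEmbedding Q.extendedEdges k ψ) {n : ℕ}
    (G : SimpleGraph (Fin n)) :
    (∃ t ∈ Q.answer (Q.cliqueDatabase ψ (graphTables G 0)),
      DigitsConsistent ψ (graphTables G 0) t) ↔ ¬ G.CliqueFree k := by
  have hk := hψ.three_le
  rw [not_cliqueFree_iff_cell (by omega)]
  set Γ := graphTables G 0 with hΓ
  constructor
  · rintro ⟨t, ⟨val, hval, rfl⟩, hF⟩
    have hcons : ∀ e ∈ Q.extendedEdges, DigitsConsistent ψ Γ fun v : e => val v := by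
      rintro e (rfl | ⟨j, rfl⟩)
      · exact hF
      · obtain ⟨ρ, hρ, hadj, h⟩ := mem_cliqueDatabase.1 (hval j)
        rw [h]
        exact digitsConsistent_code hρ hadj
    refine hψ.exists_clique (fun v => ?_)
      (fun v i => val v / Γ.length ^ (i : ℕ) % Γ.length) (fun a b => 1 ≤ Γ.cell a b) ?_ ?_
    · obtain ⟨j, hj⟩ := Q.covers v
      exact ⟨_, .inr ⟨j, rfl⟩, hj⟩
    · intro e he u hu v hv i hui hvi
      -- The tests compare by `≤` only; equality comes from testing both orders.
      have h1 := hcons e he i i ⟨u, hu⟩ ⟨v, hv⟩ hui hvi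
      have h2 := hcons e he i i ⟨v, hv⟩ ⟨u, hu⟩ hvi hui
      rw [if_pos rfl] at h1 h2
      exact le_antisymm h1 h2
    · intro e he u hu v hv i j hij hui hvj
      have := hcons e he i j ⟨u, hu⟩ ⟨v, hv⟩ hui hvj
      rwa [if_neg hij] at this
  · rintro ⟨a, ha⟩
    have hlt : ∀ i, a i < Γ.length := fun i => by
      have : Nontrivial (Fin k) := Fin.nontrivial_iff_two_le.2 (by omega)
      obtain ⟨j, hj⟩ := exists_ne i
      rw [hΓ, length_graphTables]
      exact ((one_le_cell_graphTables G _ _).1 (ha i j hj.symm)).1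
    let ρ : ℕ → ℕ := fun r => if h : r < k then a ⟨r, h⟩ else 0
    have hρ : ∀ i : Fin k, ρ i = a i := fun i => by simp [ρ]
    refine ⟨_, ⟨code ψ Γ.length ρ, fun j => mem_cliqueDatabase.2 ⟨ρ, fun i _ => ?_,
      fun i _ j _ hij => ?_, rfl⟩, rfl⟩, digitsConsistent_code (fun i _ => ?_)
      fun i _ j _ hij => ?_⟩
    · rw [hρ]; exact hlt i
    · rw [hρ, hρ]; exact ha i j hij
    · rw [hρ]; exact hlt i
    · rw [hρ, hρ]; exact ha i j hij

variable (Q ψ)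

/-- Emit the database `cliqueDatabase` of the graph in input table `0`. -/
noncomputable def emitDatabase : Prog :=
  Prog.seqList (fun j : Fin Q.m => emitCliques ψ (Q.schema j) j) (List.finRange Q.m)

theorem emits_emitDatabase (hk : 0 < k) : ∃ C : ℕ, ∀ (W : ℕ) (T : Tables),
    ((T 0).length + 2) ^ (2 * k) ≤ W → (∀ i j, (T 0).cell i j ≤ 1) →
    ∃ f : Tables, (Q.emitDatabase ψ).Emits W (State.init T) f
        (C * (max 1 (T 0).length) ^ Q.wed ψ) ∧
      (Q.cliqueDatabase ψ (T 0)).EncodedBy f := by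
  choose C hC using fun j : Fin Q.m => emits_emitCliques ψ (Q.schema j) j
  refine ⟨∑ j, C j + 1, fun W T hW hcell => ?_⟩
  choose f hf using fun j : Fin Q.m => hC j W (State.init T) hk hW hcell fun _ => rfl
  refine ⟨_, (Prog.Emits.seqList (fun j => (hf j).1) (List.finRange Q.m)).mono ?_, ?_, ?_⟩
  · rw [← Fin.sum_univ_def, add_mul, one_mul, Finset.sum_mul]
    refine add_le_add (Finset.sum_le_sum fun j _ => Nat.mul_le_mul_left _ ?_)
      (Nat.one_le_pow _ _ (by simp))
    exact Nat.pow_le_pow_right (by simp) (weakEdgeDepth_le_wed j)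
  · intro j
    refine ⟨?_, fun row => ?_⟩
    · rw [List.nodup_flatMap]
      refine ⟨fun i _ => ?_, (List.nodup_finRange _).pairwise_of_forall_ne fun i _ i' _ hii' => ?_⟩
      · by_cases hij : (j : ℕ) = i
        · rw [hij]; exact (hf i).2.1.1
        · rw [(hf i).2.2 _ hij]; exact List.nodup_nil
      · intro row h1 h2
        beta_reduce at h1 h2
        by_cases hij : (j : ℕ) = i
        · rw [(hf i').2.2 _ (by rw [hij]; exact fun h => hii' (Fin.ext h))] at h2
          simp at h2
        · rw [(hf i).2.2 _ hij] at h1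
          simp at h1
    · have hj := (hf j).2.1.2 row
      simp only [Finset.mem_coe, mem_cliqueDatabase]
      refine Iff.trans ?_ hj
      simp only [List.mem_flatMap, List.mem_finRange, true_and]
      refine ⟨?_, fun h => ⟨j, h⟩⟩
      rintro ⟨i, hi⟩
      by_cases hij : (j : ℕ) = i
      · obtain rfl := Fin.ext hij; exact hi
      · rw [(hf i).2.2 _ hij] at hi
        simp at hi
  · intro a ha
    rw [List.flatMap_eq_nil_iff]
    intro j _
    exact (hf j).2.2 a (by have := j.2; omega)

variable {Q ψ}

/-- From an evaluation algorithm for `Q` to a decision procedure for cliques. -/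
theorem EvaluatedBy.decidesClique (hψ : IsCliqueEmbedding Q.extendedEdges k ψ) {A : Prog}
    {P : ℕ → ℕ → ℕ → Prop} (hA : Q.EvaluatedBy A P) :
    ∃ pre post : Prog, pre.Elementary ∧ post.Elementary ∧ ∃ C : ℕ, ∀ τ : ℕ → ℝ,
      (∀ n N M t : ℕ, N ≤ Q.m * (max 1 n) ^ Q.wed ψ → M ≤ (max 1 n) ^ edgeDepth ψ Q.free →
        P N M t → ((C * ((max 1 n) ^ Q.wed ψ + t) : ℕ) : ℝ) ≤ τ n) →
      DecidesClique k (.seq pre (.seq (.call A) post)) τ := by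
  obtain ⟨c, hA⟩ := hA
  have hk := hψ.three_le
  obtain ⟨C₁, h₁⟩ := Q.emits_emitDatabase ψ (by omega)
  obtain ⟨C₂, h₂⟩ := emits_emitConsistent ψ Q.free
  refine ⟨Q.emitDatabase ψ, emitConsistent ψ Q.free,
    Prog.elementary_seqList (fun j => elementary_emitCliques ψ _ _) _,
    elementary_emitConsistent ψ Q.free, C₁ + 1 + 2 * C₂, fun τ hτ => ?_⟩
  -- The summands provide, in turn, for the registers of `A`, the number of answers, the column
  -- positions and the codes.
  refine ⟨(Q.m + Q.wed ψ + 2 * k + 2) * c + edgeDepth ψ Q.free + Q.n + 2 * k, fun n G => ?_⟩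
  set W := (n + 2) ^ ((Q.m + Q.wed ψ + 2 * k + 2) * c + edgeDepth ψ Q.free + Q.n + 2 * k) with hW
  have hWle : ∀ {a e : ℕ}, a ≤ (n + 2) ^ e →
      e ≤ (Q.m + Q.wed ψ + 2 * k + 2) * c + edgeDepth ψ Q.free + Q.n + 2 * k → a ≤ W :=
    fun ha he => ha.trans (Nat.pow_le_pow_right (by omega) he)
  have hlen := length_graphTables G
  obtain ⟨f, hf, henc⟩ := h₁ W (graphTables G) (hWle (by rw [hlen]) (by omega))
    (cell_graphTables_le G)
  set D := Q.cliqueDatabase ψ (graphTables G 0) with hD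
  have hsize : D.size ≤ Q.m * (max 1 n) ^ Q.wed ψ := by
    simpa only [hlen] using size_cliqueDatabase_le (Q := Q) (ψ := ψ) (graphTables G 0)
  have hout : Q.outSize D ≤ n ^ edgeDepth ψ Q.free := by
    simpa only [hlen] using outSize_cliqueDatabase_le (Q := Q) (ψ := ψ) (graphTables G 0)
  have hval : D.ValuesLE ((n + 2) ^ (2 * k)) := by
    simpa only [hlen] using cliqueDatabase_valuesLE (Q := Q) (ψ := ψ) (graphTables G 0)
  obtain ⟨O, t, ⟨s', hrun, rfl⟩, hO, hP⟩ := hA D _ f hval henc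
  have hregs : (D.size + (n + 2) ^ (2 * k) + 2) ^ c ≤ W := by
    refine hWle (e := (Q.m + Q.wed ψ + 2 * k + 2) * c) ?_ (by omega)
    rw [pow_mul _ _ c]
    refine Nat.pow_le_pow_left ?_ _
    have e1 : D.size ≤ (n + 2) ^ (Q.m + Q.wed ψ + 2 * k) := by
      refine hsize.trans ?_
      rw [pow_add, pow_add]
      refine le_trans (Nat.mul_le_mul (Nat.lt_two_pow_self.le.trans
        (Nat.pow_le_pow_left (by omega) _)) (Nat.pow_le_pow_left (by omega) _))
        (Nat.le_mul_of_pos_right _ (by positivity))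
    have e2 : (n + 2) ^ (2 * k) ≤ (n + 2) ^ (Q.m + Q.wed ψ + 2 * k) :=
      Nat.pow_le_pow_right (by omega) (by omega)
    have e3 : 2 ≤ (n + 2) ^ (Q.m + Q.wed ψ + 2 * k) :=
      calc 2 ≤ (n + 2) ^ 1 := by simp
        _ ≤ _ := Nat.pow_le_pow_right (by omega) (by omega)
    rw [pow_add _ _ 2]
    nlinarith [Nat.pow_le_pow_left (show 2 ≤ n + 2 by omega) 2]
  have hOlen : (s'.buf 0).length ≤ n ^ edgeDepth ψ Q.free :=
    (hO.length_le (Q.answer_finite D)).trans hout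
  -- Writing a row takes a step, so testing all answers costs `O(t)`; the bound `n ^ d⁺`, which may
  -- exceed `n ^ k`, does not enter the time.
  have hOt : (s'.buf 0).length ≤ t := by simpa [State.init] using hrun.length_buf_le 0
  obtain ⟨g, hg, hgO⟩ := h₂ W { State.init (graphTables G) with res := s'.buf } (Q.answer D) hO
    (hWle (hOlen.trans (Nat.pow_le_pow_left (by omega) _)) (by omega))
    (hWle (Nat.lt_two_pow_self.le.trans (Nat.pow_le_pow_left (by omega) Q.n)) (by omega))
    (Nat.one_le_pow _ _ (by omega))
    (hWle (e := 1) (by simp [State.init, hlen]) (by omega))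
    (hWle (e := k) (by simp [State.init, hlen]) (by omega))
    (cell_graphTables_le G)
    (fun t ht v => by
      obtain ⟨ρ, hρ, h⟩ := exists_code_of_mem_answer ht v
      rw [h]
      refine hWle ((code_le fun i hi => (hρ i hi).le).trans ?_) (e := 2 * k) (by omega)
      rw [hlen])
  obtain ⟨t₁, ht₁, r₁⟩ := hf fun _ => []
  obtain ⟨t₂, ht₂, r₂⟩ := hg fun _ => []
  have rA := Run.call (W := W) { State.init (graphTables G) with buf := f } _ A t
    (hrun.mono hregs)
  have r := Run.seq _ _ _ _ _ _ _ r₁ (Run.seq _ _ _ _ _ _ _ rA r₂)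
  refine ⟨g, t₁ + (t + 1 + t₂), ⟨_, r, ?_⟩, ?_, ?_⟩
  · simp
  · rw [hgO]
    exact exists_digitsConsistent_iff hψ G
  · refine le_trans ?_ (hτ n D.size (Q.outSize D) t hsize
      (hout.trans (Nat.pow_le_pow_left (le_max_right _ _) _)) hP)
    rw [Nat.cast_le]
    change t₂ ≤ C₂ * ((s'.buf 0).length + 1) at ht₂
    rw [hlen] at ht₁
    have hp : 1 ≤ (max 1 n) ^ Q.wed ψ := Nat.one_le_pow _ _ (by simp)
    have : C₂ * ((s'.buf 0).length + 1) ≤ C₂ * (t + 1) := Nat.mul_le_mul_left _ (by omega)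
    generalize (max 1 n) ^ Q.wed ψ = p at *
    have e1 : C₂ * 1 ≤ C₂ * p := Nat.mul_le_mul_left _ hp
    have e2 : (C₁ + 1 + 2 * C₂) * (p + t) =
      C₁ * p + p + 2 * (C₂ * p) + C₁ * t + t + 2 * (C₂ * t) := by ring
    rw [e2]
    have e3 : C₂ * (t + 1) = C₂ * t + C₂ := by ring
    have := Nat.zero_le (C₁ * t)
    omega

end CQ

/-! ## Databases in which a single variable varies -/

namespace CQ

variable (Q : CQ)

/-- The variable `v` takes the values `0, …, M - 1`, all other variables are `0`. -/
def singleVariableDatabase (v : Fin Q.n) (M : ℕ) : Q.Database := fun _ =>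
  (Finset.range M).image fun a u => if (u : Fin Q.n) = v then a else 0

variable {Q} {v : Fin Q.n} {M : ℕ}

theorem le_size_singleVariableDatabase : M ≤ (Q.singleVariableDatabase v M).size := by
  obtain ⟨j, hj⟩ := Q.covers v
  have h : (Q.singleVariableDatabase v M j).card = M := by
    rw [singleVariableDatabase, Finset.card_image_of_injective, Finset.card_range]
    intro a b hab
    simpa using congrFun hab ⟨v, hj⟩
  calc M = (Q.singleVariableDatabase v M j).card := h.symm
    _ ≤ _ := Finset.single_le_sum (f := fun j => (Q.singleVariableDatabase v M j).card)
      (fun _ _ => Nat.zero_le _) (Finset.mem_univ j)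

theorem exists_valuesLE (D : Q.Database) : ∃ V, D.ValuesLE V := by
  have h : ∀ j, ∀ t : Q.schema j → ℕ, ∀ a, t a ≤ ∑ a, t a := fun j t a =>
    Finset.single_le_sum (fun _ _ => Nat.zero_le _) (Finset.mem_univ a)
  refine ⟨∑ j, ∑ t ∈ D j, ∑ a, t a, fun j t ht a => (h j t a).trans ?_⟩
  refine (Finset.single_le_sum (f := fun t : Q.schema j → ℕ => ∑ a, t a)
    (fun _ _ => Nat.zero_le _) ht).trans ?_
  exact Finset.single_le_sum (f := fun j => ∑ t ∈ D j, ∑ a, t a) (fun _ _ => Nat.zero_le _)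
    (Finset.mem_univ j)

/-- Atoms without `v` contain only the zero tuple, so the value at `v` determines the answer. -/
theorem answer_singleVariableDatabase_subset :
    Q.answer (Q.singleVariableDatabase v M) ⊆
      ((Finset.range M).image fun a (u : Q.free) => if (u : Fin Q.n) = v then a else 0 :
        Finset (Q.free → ℕ)) := by
  rintro t ⟨val, hval, rfl⟩
  have hu : ∀ u, ∃ a < M, val u = if u = v then a else 0 := by
    intro u
    obtain ⟨j, hj⟩ := Q.covers u
    obtain ⟨a, ha, h⟩ := Finset.mem_image.1 (hval j)
    exact ⟨a, Finset.mem_range.1 ha, (congrFun h ⟨u, hj⟩).symm⟩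
  obtain ⟨a, ha, hav⟩ := hu v
  rw [Finset.mem_coe, Finset.mem_image]
  refine ⟨a, Finset.mem_range.2 ha, funext fun u => ?_⟩
  obtain ⟨b, -, hb⟩ := hu u
  by_cases huv : (u : Fin Q.n) = v
  · simp [huv, hav]
  · rw [hb, if_neg huv, if_neg huv]

theorem outSize_singleVariableDatabase_le : Q.outSize (Q.singleVariableDatabase v M) ≤ M := by
  refine (Set.ncard_le_ncard answer_singleVariableDatabase_subset (Finset.finite_toSet _)).trans ?_
  rw [Set.ncard_coe_finset]
  exact Finset.card_image_le.trans_eq (Finset.card_range M)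

theorem outSize_singleVariableDatabase_le_one (hv : v ∉ Q.free) :
    Q.outSize (Q.singleVariableDatabase v M) ≤ 1 := by
  have h : Q.answer (Q.singleVariableDatabase v M) ⊆ {fun _ => 0} := by
    intro t ht
    have := answer_singleVariableDatabase_subset ht
    rw [Finset.mem_coe, Finset.mem_image] at this
    obtain ⟨a, -, rfl⟩ := this
    exact funext fun u => if_neg fun huv : (u : Fin Q.n) = v => hv (huv ▸ u.2)
  exact (Set.ncard_le_ncard h).trans (by simp)

end CQ

/-- `N ^ (1 - s)` is unbounded. -/
theorem not_forall_exists_le_mul_rpow {C s : ℝ} (hs : s < 1) :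
    ¬ ∀ M : ℕ, ∃ N : ℕ, M ≤ N ∧ (N : ℝ) ≤ C * (max 1 N : ℝ) ^ s := by
  intro h
  have hlim := (tendsto_rpow_atTop (sub_pos.2 hs)).comp tendsto_natCast_atTop_atTop (α := ℕ)
  obtain ⟨M, hM⟩ := Filter.eventually_atTop.1 (hlim.eventually_gt_atTop C)
  obtain ⟨N, hMN, hN⟩ := h (max M 1)
  have hN1 : (1 : ℝ) ≤ N := by exact_mod_cast (le_max_right _ _).trans hMN
  have hN0 : (0 : ℝ) < N := by linarith
  rw [max_eq_right hN1] at hN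
  have h1 := hM N ((le_max_left _ _).trans hMN)
  simp only [Function.comp_apply] at h1
  have h2 : (N : ℝ) = (N : ℝ) ^ (1 - s) * (N : ℝ) ^ s := by
    rw [← Real.rpow_add hN0]; simp
  have h3 : 0 < (N : ℝ) ^ s := Real.rpow_pos_of_pos hN0 s
  nlinarith

/-! ## The exponents -/

section Exponents

variable {Q : CQ} {k : ℕ} {ψ : Fin k → Finset (Fin Q.n)}

theorem one_le_wed (hψ : IsCliqueEmbedding Q.extendedEdges k ψ) : 1 ≤ Q.wed ψ := by
  have hk := hψ.three_le
  obtain ⟨v, hv⟩ := hψ.nonempty ⟨0, by omega⟩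
  obtain ⟨j, hj⟩ := Q.covers v
  refine le_trans ?_ (CQ.weakEdgeDepth_le_wed (ψ := ψ) j)
  exact Finset.card_pos.2 ⟨_, mem_metBy hj hv⟩

theorem wed_le : Q.wed ψ ≤ k :=
  Finset.sup_le fun _ _ => (Finset.card_le_univ _).trans_eq (Fintype.card_fin k)

/-- Choosing for each `i` a vertex of `F` in `ψ i` gives `k` distinct incidences among those that
`edgeDepth` counts. -/
theorem le_edgeDepth {V : Type*} [DecidableEq V] {k : ℕ} {ψ : Fin k → Finset V} {F : Finset V}
    (h : ∀ i, ∃ v ∈ F, v ∈ ψ i) : k ≤ edgeDepth ψ F := by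
  choose f hf hψ using h
  calc k = (Finset.univ : Finset (Fin k)).card := by simp
    _ = ∑ v ∈ F, ((Finset.univ : Finset (Fin k)).filter fun i => f i = v).card :=
        Finset.card_eq_sum_card_fiberwise fun i _ => hf i
    _ ≤ edgeDepth ψ F := Finset.sum_le_sum fun v _ => Finset.card_le_card fun i hi => by
        rw [Finset.mem_filter] at hi ⊢
        exact ⟨hi.1, hi.2 ▸ hψ i⟩

/-- A positive power of a quantity of order `B ^ w`. -/
theorem rpow_le_of_le_mul_pow {a K B z : ℝ} {w : ℕ} (ha : 1 ≤ a) (hK : 0 ≤ K) (hB : 1 ≤ B)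
    (h : a ≤ K * B ^ w) : a ^ z ≤ K ^ max z 0 * B ^ ((w : ℝ) * max z 0) := by
  calc a ^ z ≤ a ^ max z 0 := Real.rpow_le_rpow_of_exponent_le ha (le_max_left _ _)
    _ ≤ (K * B ^ w) ^ max z 0 := Real.rpow_le_rpow (by linarith) h (le_max_right _ _)
    _ = K ^ max z 0 * B ^ ((w : ℝ) * max z 0) := by
        rw [Real.mul_rpow hK (by positivity), Real.rpow_mul (by linarith), Real.rpow_natCast]

/-- Only upper bounds on `|D|` and `|OUT|` are known, so a negative exponent gains nothing and is
replaced by `0`. -/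
theorem not_evaluatedBy_of_wed_lt {𝒞 : Set Prog} (h𝒞 : ClosedUnderElementaryProcessing 𝒞)
    (hψ : IsCliqueEmbedding Q.extendedEdges k ψ) (hconj : BooleanCliqueConjecture 𝒞 k)
    {z z' : ℝ} (hw : Q.wed ψ < k)
    (hz : (Q.wed ψ : ℝ) * max z 0 + (edgeDepth ψ Q.free : ℝ) * max z' 0 < k) :
    ¬ ∃ A ∈ 𝒞, ∃ C : ℝ, Q.EvaluatedBy A fun N M t =>
      (t : ℝ) ≤ C * ((max 1 N : ℝ) ^ z * (max 1 M : ℝ) ^ z') := by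
  rintro ⟨A, hA, C, hev⟩
  obtain ⟨pre, post, hpre, hpost, C₀, hdec⟩ := hev.decidesClique hψ
  set e : ℝ := (Q.wed ψ : ℝ) * max z 0 + (edgeDepth ψ Q.free : ℝ) * max z' 0 with he
  -- The saving is at most `1` for the `n ^ wed ≤ n ^ (k - 1)` steps of the preparation, and at most
  -- `k - e` for the evaluation.
  set δ : ℝ := min 1 (k - e) with hδ
  have hδ1 : δ ≤ 1 := min_le_left _ _
  have hδe : δ ≤ k - e := min_le_right _ _
  set K : ℝ := (Q.m + 1 : ℝ) ^ max z 0 with hK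
  have hK0 : 0 ≤ K := by positivity
  refine hconj ⟨δ, lt_min one_pos (sub_pos.2 hz), _, h𝒞 A hA pre post hpre hpost,
    C₀ * (1 + |C| * K), hdec _ fun n N M t hN hM ht => ?_⟩
  have hB : (1 : ℝ) ≤ max 1 (n : ℝ) := le_max_left _ _
  have hN' : (max 1 N : ℝ) ≤ (Q.m + 1) * (max 1 n : ℝ) ^ Q.wed ψ := by
    have h1 : (N : ℝ) ≤ Q.m * (max 1 n : ℝ) ^ Q.wed ψ := by exact_mod_cast hN
    have h2 : (1 : ℝ) ≤ (max 1 n : ℝ) ^ Q.wed ψ := one_le_pow₀ hB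
    have h3 : (0 : ℝ) ≤ Q.m := Nat.cast_nonneg _
    refine max_le ?_ ?_ <;> nlinarith
  have hM' : (max 1 M : ℝ) ≤ 1 * (max 1 n : ℝ) ^ edgeDepth ψ Q.free := by
    have h1 : (M : ℝ) ≤ (max 1 n : ℝ) ^ edgeDepth ψ Q.free := by exact_mod_cast hM
    rw [one_mul]
    exact max_le (one_le_pow₀ hB) h1
  have b1 := rpow_le_of_le_mul_pow (z := z) (le_max_left 1 (N : ℝ)) (by positivity) hB hN'
  have b2 := rpow_le_of_le_mul_pow (z := z') (le_max_left 1 (M : ℝ)) zero_le_one hB hM'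
  rw [Real.one_rpow, one_mul] at b2
  push_cast
  set B : ℝ := max 1 (n : ℝ) with hBdef
  have hB0 : 0 < B := by linarith
  have hprod : (max 1 N : ℝ) ^ z * (max 1 M : ℝ) ^ z' ≤ K * B ^ (k - δ : ℝ) :=
    calc (max 1 N : ℝ) ^ z * (max 1 M : ℝ) ^ z'
        ≤ (K * B ^ ((Q.wed ψ : ℝ) * max z 0)) * B ^ ((edgeDepth ψ Q.free : ℝ) * max z' 0) :=
          mul_le_mul b1 b2 (by positivity) (by positivity)
      _ = K * B ^ e := by rw [mul_assoc, ← Real.rpow_add hB0]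
      _ ≤ K * B ^ (k - δ : ℝ) := mul_le_mul_of_nonneg_left
          (Real.rpow_le_rpow_of_exponent_le hB (by linarith)) hK0
  have ht' : (t : ℝ) ≤ |C| * (K * B ^ (k - δ : ℝ)) :=
    ht.trans (mul_le_mul (le_abs_self C) hprod (by positivity) (abs_nonneg C))
  have hwk : B ^ Q.wed ψ ≤ B ^ (k - δ : ℝ) := by
    rw [← Real.rpow_natCast]
    refine Real.rpow_le_rpow_of_exponent_le hB ?_
    have : (Q.wed ψ : ℝ) + 1 ≤ k := by exact_mod_cast hw
    linarith
  calc (C₀ : ℝ) * (B ^ Q.wed ψ + t)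
      ≤ C₀ * (B ^ (k - δ : ℝ) + |C| * (K * B ^ (k - δ : ℝ))) :=
        mul_le_mul_of_nonneg_left (add_le_add hwk ht') (Nat.cast_nonneg _)
    _ = C₀ * (1 + |C| * K) * B ^ (k - δ : ℝ) := by ring

/-- If the weak edge depth is `k`, then reading the input takes too long. -/
theorem not_evaluatedBy_of_wed_eq (hψ : IsCliqueEmbedding Q.extendedEdges k ψ)
    (hw : Q.wed ψ = k) {z z' : ℝ} (hz : z < 1)
    (hzz : k ≤ edgeDepth ψ Q.free → z + z' < 1) :
    ¬ ∃ A : Prog, ∃ C : ℝ, Q.EvaluatedBy A fun N M t =>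
      (N : ℝ) + (t : ℝ) ≤ C * ((max 1 N : ℝ) ^ z * (max 1 M : ℝ) ^ z') := by
  rintro ⟨A, C, c, hev⟩
  have hk := hψ.three_le
  have hev' : ∀ D : Q.Database, (D.size : ℝ) ≤
      C * ((max 1 D.size : ℝ) ^ z * (max 1 (Q.outSize D) : ℝ) ^ z') := fun D => by
    obtain ⟨V, hV⟩ := CQ.exists_valuesLE D
    obtain ⟨T, hT⟩ := D.exists_encodedBy
    obtain ⟨O, t, -, -, h⟩ := hev D V T hV hT
    have := Nat.cast_nonneg (α := ℝ) t
    linarith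
  -- Some atom attains the maximum `k`, so its schema meets every `ψ i`.
  obtain ⟨j, -, hj⟩ := Finset.exists_mem_eq_sup (Finset.univ : Finset (Fin Q.m))
    (by
      obtain ⟨v, -⟩ := hψ.nonempty ⟨0, by omega⟩
      exact ⟨(Q.covers v).choose, Finset.mem_univ _⟩)
    fun j => weakEdgeDepth ψ (Q.schema j)
  have hmet : ∀ i : Fin k, ∃ v ∈ Q.schema j, v ∈ ψ i := by
    have huniv : metBy ψ (Q.schema j) = Finset.univ := by
      rw [← Finset.card_eq_iff_eq_univ, Fintype.card_fin]
      exact hj.symm.trans hw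
    intro i
    have hi : i ∈ metBy ψ (Q.schema j) := huniv ▸ Finset.mem_univ i
    obtain ⟨v, hv⟩ := (Finset.mem_filter.1 hi).2
    rw [Finset.mem_inter] at hv
    exact ⟨v, hv.2, hv.1⟩
  by_cases hfree : ∀ i : Fin k, ∃ v ∈ Q.free, v ∈ ψ i
  · have hs : z + max z' 0 < 1 := by
      rcases max_cases z' 0 with ⟨h, -⟩ | ⟨h, -⟩ <;> rw [h]
      · exact hzz (le_edgeDepth hfree)
      · simpa using hz
    obtain ⟨v, -, -⟩ := hmet ⟨0, by omega⟩
    refine not_forall_exists_le_mul_rpow (C := |C|) hs fun M =>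
      ⟨_, CQ.le_size_singleVariableDatabase (v := v), (hev' _).trans ?_⟩
    have hle : (Q.outSize (Q.singleVariableDatabase v M) : ℝ) ≤
        (Q.singleVariableDatabase v M).size := by
      exact_mod_cast CQ.outSize_singleVariableDatabase_le.trans CQ.le_size_singleVariableDatabase
    generalize ((Q.singleVariableDatabase v M).size : ℝ) = N at *
    generalize (Q.outSize (Q.singleVariableDatabase v M) : ℝ) = O at *
    have hN : 0 < max 1 N := lt_max_of_lt_left one_pos
    have hO : 0 < max 1 O := lt_max_of_lt_left one_pos
    refine mul_le_mul (le_abs_self C) ?_ (by positivity) (abs_nonneg C)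
    rw [Real.rpow_add hN]
    refine mul_le_mul_of_nonneg_left ?_ (by positivity)
    exact (Real.rpow_le_rpow_of_exponent_le (le_max_left _ _) (le_max_left _ _)).trans
      (Real.rpow_le_rpow hO.le (max_le_max le_rfl hle) (le_max_right _ _))
  -- Otherwise some variable is not free; letting it vary keeps `|OUT| ≤ 1`, and `z < 1` suffices.
  · obtain ⟨i, hi⟩ := not_forall.1 hfree
    obtain ⟨v, -, hvi⟩ := hmet i
    have hv : v ∉ Q.free := fun h => hi ⟨v, h, hvi⟩
    refine not_forall_exists_le_mul_rpow (C := C) hz fun M =>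
      ⟨_, CQ.le_size_singleVariableDatabase (v := v), (hev' _).trans_eq ?_⟩
    have hle : (Q.outSize (Q.singleVariableDatabase v M) : ℝ) ≤ 1 := by
      exact_mod_cast CQ.outSize_singleVariableDatabase_le_one hv
    rw [max_eq_left hle, Real.one_rpow, mul_one]

end Exponents

/-! ### The main theorem -/

theorem mainTheorem6 (𝒞 : Set Prog) (h𝒞 : ClosedUnderElementaryProcessing 𝒞)
    (Q : CQ) (k : ℕ) (ψ : Fin k → Finset (Fin Q.n))
    (hψ : IsCliqueEmbedding Q.extendedEdges k ψ)
    (x y : ℝ) (hx : 0 < x) (hy : 0 < y)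
    (hxy : x * (Q.wed ψ : ℝ) + y * (edgeDepth ψ Q.free : ℝ) ≤ (k : ℝ))
    (hconj : BooleanCliqueConjecture 𝒞 k)
    (ε ε' : ℝ) (hε : 0 ≤ ε) (hε' : 0 ≤ ε') (hsum : 0 < ε + ε')
    (hfree : edgeDepth ψ Q.free = 0 → 0 < ε) :
    (¬ ∃ A ∈ 𝒞, ∃ C : ℝ, Q.EvaluatedBy A fun N M t =>
        (N : ℝ) + (t : ℝ) ≤ C * ((max 1 N : ℝ) ^ (x - ε) * (max 1 M : ℝ) ^ (y - ε'))) ∧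
    (Q.wed ψ < k →
      ¬ ∃ A ∈ 𝒞, ∃ C : ℝ, Q.EvaluatedBy A fun N M t =>
        (t : ℝ) ≤ C * ((max 1 N : ℝ) ^ (x - ε) * (max 1 M : ℝ) ^ (y - ε'))) := by
  have hw1 : (1 : ℝ) ≤ Q.wed ψ := by exact_mod_cast one_le_wed hψ
  have hd0 : (0 : ℝ) ≤ edgeDepth ψ Q.free := Nat.cast_nonneg _
  have hdpos : ¬ 0 < ε → (1 : ℝ) ≤ edgeDepth ψ Q.free := fun h => by
    exact_mod_cast Nat.one_le_iff_ne_zero.2 fun h0 => h (hfree h0)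
  -- The lowered exponent has positive weight: `wed ≥ 1`, and `d⁺ ≥ 1` when `ε = 0`.
  have hexp : (Q.wed ψ : ℝ) * max (x - ε) 0 + (edgeDepth ψ Q.free : ℝ) * max (y - ε') 0 < k := by
    have hzx : max (x - ε) 0 ≤ x := max_le (by linarith) hx.le
    have hzy : max (y - ε') 0 ≤ y := max_le (by linarith) hy.le
    by_cases hpos : 0 < ε
    · have : max (x - ε) 0 < x := max_lt (by linarith) hx
      nlinarith
    · have := hdpos hpos
      have : max (y - ε') 0 < y := max_lt (by linarith) hy
      nlinarith
  have hlt := fun hw => not_evaluatedBy_of_wed_lt h𝒞 hψ hconj hw hexp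
  refine ⟨?_, hlt⟩
  rcases (wed_le (ψ := ψ)).lt_or_eq with hw | hw
  · rintro ⟨A, hA, C, c, h⟩
    refine hlt hw ⟨A, hA, C, c, fun D V T hV hT => ?_⟩
    obtain ⟨O, t, hO, hl, hP⟩ := h D V T hV hT
    exact ⟨O, t, hO, hl, (le_add_of_nonneg_left (Nat.cast_nonneg _)).trans hP⟩
  · rintro ⟨A, -, h⟩
    have hk : (3 : ℝ) ≤ k := by exact_mod_cast hψ.three_le
    rw [hw] at hxy
    refine not_evaluatedBy_of_wed_eq hψ hw ?_ ?_ ⟨A, h⟩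
    -- Dividing `x k + y d⁺ ≤ k` by `k` gives `x ≤ 1`, strictly if `d⁺ ≥ 1`, as it is when `ε = 0`.
    · by_cases hpos : 0 < ε
      · nlinarith
      · have := hdpos hpos
        nlinarith
    -- Here `d⁺ ≥ k` gives `x + y ≤ 1`, and `ε + ε' > 0` makes the inequality strict.
    · intro hkd
      have : (k : ℝ) ≤ edgeDepth ψ Q.free := by exact_mod_cast hkd
      nlinarith
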